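/- Let $p\ge 1$ and $n>p+3$ be integers, let $\Sigma\in\mathbb{R}^{p\times p}$ be symmetric positive definite, and let $h_{np}:[0,\infty)\to\mathbb{R}$ be a density generator in dimension $np$, i.e. a Borel measurable nonnegative function with $\frac{\pi^{np/2}}{\Gamma(np/2)}\int_0^\infty h_{np}(t)\,t^{\frac{np}{2}-1}\,dt=1$. For $k\in\mathbb{Z}$ put $$m_k=\frac{\pi^{np/2}}{\Gamma(np/2)}\int_0^\infty h_{np}(t)\,t^{\frac{np}{2}+k-1}\,dt .$$ For a symmetric positive definite $M\in\mathbb{R}^{p\times p}$, the Elliptical Wishart distribution $\mathcal{EW}(n,M,h_{np})$ is the law of $XX^\top$, where $X$ is a random matrix in $\mathbb{R}^{p\times n}$ such that $\operatorname{vec}(X)$ (column-wise vectorization) has Lebesgue density $x\mapsto |I_n\otimes M|^{-1/2}\,h_{np}\big(x^\top (I_n\otimes M)^{-1}x\big)$ on $\mathbb{R}^{np}$. A random $p\times p$ matrix $S$ has the Inverse Elliptical Wishart distribution $\mathcal{EW}^{-1}(n,\Sigma,h_{np})$ if $S^{-1}\sim\mathcal{EW}(n,\Sigma^{-1},h_{np})$.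 The variance of a random matrix $S$ is $\operatorname{Var}[S]=E[\operatorname{vec}(S)\operatorname{vec}(S)^\top]-\operatorname{vec}(E[S])\operatorname{vec}(E[S])^\top$, and $K_{p,p}$ is the commutation matrix, $K_{p,p}\operatorname{vec}(A)=\operatorname{vec}(A^\top)$ for $A\in\mathbb{R}^{p\times p}$. **Proposition (Variance).** Suppose that $m_{-1}$ and $m_{-2}$ are finite and that $S\sim\mathcal{EW}^{-1}(n,\Sigma,h_{np})$. Then all entries of $S$ are square integrable, and $$\operatorname{Var}[S]=e_{n,p}\,(I_{p^2}+K_{p,p})(\Sigma\otimes\Sigma)+(n-p-2)\,f_{n,p}\,\operatorname{vec}(\Sigma)\operatorname{vec}(\Sigma)^\top,$$ where $$e_{n,p}=\frac{(np-2)(np-4)}{(n-p)(n-p-1)(n-p-3)}\,m_{-2},\qquad f_{n,p}=e_{n,p}-\frac{1}{n-p-2}\left(\frac{np-2}{n-p-1}\,m_{-1}\right)^2 .$$ -/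

import Mathlib

open MeasureTheory ProbabilityTheory
open scoped Kronecker Matrix

namespace EllipticalWishart

/-- The Borel structure on real matrices: the product one, entry by entry. -/
instance instMeasurableSpaceMatrix {m n : Type*} : MeasurableSpace (Matrix m n ℝ) :=
  inferInstanceAs (MeasurableSpace (m → n → ℝ))

/-- The constant `π^(d/2) / Γ(d/2)`. -/
noncomputable def radialConstant (d : ℕ) : ℝ :=
  Real.pi ^ ((d : ℝ) / 2) / Real.Gamma ((d : ℝ) / 2)

/-- `h : [0, ∞) → ℝ` is a density generator in dimension `d`: it is Borel measurable and nonnegative,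
and `π^(d/2) / Γ(d/2) * ∫₀^∞ h(t) t^(d/2 - 1) dt = 1`. (Only the values of `h` on `[0, ∞)` matter.
The integral being nonzero, the integrand is integrable.) -/
structure IsDensityGenerator (d : ℕ) (h : ℝ → ℝ) : Prop where
  measurable : Measurable (fun t : Set.Ici (0 : ℝ) => h t)
  nonneg : ∀ t : ℝ, 0 ≤ t → 0 ≤ h t
  normalized : radialConstant d * ∫ t in Set.Ioi (0 : ℝ), h t * t ^ ((d : ℝ) / 2 - 1) = 1

/-- The modular moment
`m_k = E[‖x‖^(2k)] = π^(d/2) / Γ(d/2) * ∫₀^∞ h(t) t^(d/2 + k - 1) dt`, `k ∈ ℤ`. -/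
noncomputable def modularMoment (d : ℕ) (h : ℝ → ℝ) (k : ℤ) : ℝ :=
  radialConstant d * ∫ t in Set.Ioi (0 : ℝ), h t * t ^ ((d : ℝ) / 2 + (k : ℝ) - 1)

/-- The modular moment `m_k` is finite: the integral that defines it converges. -/
def FiniteModularMoment (d : ℕ) (h : ℝ → ℝ) (k : ℤ) : Prop :=
  IntegrableOn (fun t : ℝ => h t * t ^ ((d : ℝ) / 2 + (k : ℝ) - 1)) (Set.Ioi (0 : ℝ))

/-- The centered elliptical distribution `E_d(0, M, h)` on `ℝ^ι`, `d = |ι|`: the law with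
Lebesgue density `x ↦ |M|^(-1/2) h(xᵀ M⁻¹ x)`. -/
noncomputable def ellipticalLaw {ι : Type*} [Fintype ι] [DecidableEq ι]
    (M : Matrix ι ι ℝ) (h : ℝ → ℝ) : Measure (ι → ℝ) :=
  (volume : Measure (ι → ℝ)).withDensity fun x =>
    ENNReal.ofReal (M.det ^ (-(1 / 2) : ℝ) * h (x ⬝ᵥ (M⁻¹ *ᵥ x)))

/-- Inverse of column-wise vectorization: the matrix `A` with `vec A = v`. -/
def unvec {m n : Type*} (v : n × m → ℝ) : Matrix m n ℝ :=
  Matrix.of fun i j => v (j, i)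

theorem vec_unvec {m n : Type*} (v : n × m → ℝ) : (unvec v).vec = v := rfl

theorem unvec_vec {m n : Type*} (A : Matrix m n ℝ) : unvec A.vec = A := rfl

/-- The matrix-variate elliptical distribution `E_{p,n}(0, S, T, h)` on `ℝ^{p×n}`: the law of `X`
with `vec X ∼ E_{np}(0, T ⊗ S, h)`. -/
noncomputable def matrixEllipticalLaw {p n : ℕ} (S : Matrix (Fin p) (Fin p) ℝ)
    (T : Matrix (Fin n) (Fin n) ℝ) (h : ℝ → ℝ) : Measure (Matrix (Fin p) (Fin n) ℝ) :=
  (ellipticalLaw (T ⊗ₖ S) h).map unvec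

/-- The Elliptical Wishart distribution `EW(n, S, h)` on `ℝ^{p×p}`: the law of `X Xᵀ` for
`X ∼ E_{p,n}(0, S, I_n, h)`. -/
noncomputable def ellipticalWishartLaw {p : ℕ} (n : ℕ) (S : Matrix (Fin p) (Fin p) ℝ)
    (h : ℝ → ℝ) : Measure (Matrix (Fin p) (Fin p) ℝ) :=
  (matrixEllipticalLaw S (1 : Matrix (Fin n) (Fin n) ℝ) h).map fun X => X * Xᵀ

/-- The random matrix `S` has the Inverse Elliptical Wishart distribution `EW⁻¹(n, C, h)`:
`S⁻¹ ∼ EW(n, C⁻¹, h)`. -/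
def IsInverseEllipticalWishart {Ω : Type*} [MeasurableSpace Ω] (P : Measure Ω) {p : ℕ}
    (S : Ω → Matrix (Fin p) (Fin p) ℝ) (n : ℕ) (C : Matrix (Fin p) (Fin p) ℝ)
    (h : ℝ → ℝ) : Prop :=
  HasLaw (fun ω => (S ω)⁻¹) (ellipticalWishartLaw n C⁻¹ h) P

/-- The entrywise expectation of a random matrix. -/
noncomputable def matrixExpectation {Ω : Type*} [MeasurableSpace Ω] (P : Measure Ω)
    {m n : Type*} (X : Ω → Matrix m n ℝ) : Matrix m n ℝ :=
  Matrix.of fun i j => ∫ ω, X ω i j ∂P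

/-- `Var[X] = E[vec(X) vec(X)ᵀ] - vec(E[X]) vec(E[X])ᵀ`. -/
noncomputable def matrixVariance {Ω : Type*} [MeasurableSpace Ω] (P : Measure Ω)
    {m n : Type*} (X : Ω → Matrix m n ℝ) : Matrix (n × m) (n × m) ℝ :=
  matrixExpectation P (fun ω => Matrix.vecMulVec (X ω).vec (X ω).vec) -
    Matrix.vecMulVec (matrixExpectation P X).vec (matrixExpectation P X).vec

/-- The commutation matrix `K_{p,n}`, which sends `vec A` to `vec Aᵀ` for `A ∈ ℝ^{p×n}`. -/
def commutationMatrix (p n : ℕ) : Matrix (Fin p × Fin n) (Fin n × Fin p) ℝ :=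
  Matrix.of fun a b => if a = b.swap then 1 else 0

theorem commutationMatrix_mulVec_vec {p n : ℕ} (A : Matrix (Fin p) (Fin n) ℝ) :
    commutationMatrix p n *ᵥ A.vec = Aᵀ.vec := by
  ext ⟨i, j⟩
  have key : ∀ b : Fin n × Fin p, ((i, j) = b.swap) ↔ (b = (j, i)) := by
    rintro ⟨k, l⟩
    simp only [Prod.swap_prod_mk, Prod.mk.injEq]
    constructor <;> rintro ⟨h1, h2⟩ <;> exact ⟨h2.symm, h1.symm⟩
  simp [commutationMatrix, Matrix.mulVec, dotProduct, key, Matrix.vec]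

/-- `e_{n,p} = (np-2)(np-4) / ((n-p)(n-p-1)(n-p-3)) * m_{-2}`. -/
noncomputable def eCoeff (n p : ℕ) (h : ℝ → ℝ) : ℝ :=
  (((n : ℝ) * p - 2) * ((n : ℝ) * p - 4)) /
      (((n : ℝ) - p) * ((n : ℝ) - p - 1) * ((n : ℝ) - p - 3)) *
    modularMoment (n * p) h (-2)

/-- `f_{n,p} = e_{n,p} - 1 / (n-p-2) * ((np-2) / (n-p-1) * m_{-1})^2`. -/
noncomputable def fCoeff (n p : ℕ) (h : ℝ → ℝ) : ℝ :=
  eCoeff n p h -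
    1 / ((n : ℝ) - p - 2) *
      (((n : ℝ) * p - 2) / ((n : ℝ) - p - 1) * modularMoment (n * p) h (-1)) ^ 2

end EllipticalWishart

/-! In polar coordinates, the integral of a function of `X` homogeneous of degree `2k` against the
density `h(‖X‖²)` is a spherical integral, which does not see `h`, times a radial integral
proportional to `m_k`. Hence every moment needed under `h` is its Gaussian counterpart times a ratio
of modular moments (`lintegral_ellipticalWishartLaw_homogeneous`), and only Gaussian computations
remain.

For a Gaussian `X` with identity scatter, `X Xᵀ` is the Gram matrix of `p` independent standard
Gaussian rows in `ℝⁿ`. With `W` its inverse, `1 / W i i` is the squared distance from row `i` to the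
span of the other rows, a chi-square variable with `n - p + 1` degrees of freedom. The 2×2 principal
minor of `W` is `W i i` times a Schur complement that does not involve row `i`, and whose reciprocal
is a chi-square with `n - p + 2` degrees of freedom. This gives `E[W i i]`, `E[W i i ^ 2]` and the
expected minors (`lintegral_inv_gram_diag`, `lintegral_inv_gram_minor`).

The law of `W` is invariant under orthogonal conjugation, also for general `h`. Sign changes and one
rational reflection then express all `E[W i j * W k l]` through those two second-order quantities
(`IsOrthogonallyInvariant.integral_mul`). Finally, writing the scatter as `Bᵀ B`, the general matrix
has the law of `Bᵀ W B`, and the variance formula follows by multilinearity. -/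

namespace EllipticalWishart

/-! ### Polar coordinates and radial integrals -/

section Polar

open Measure Set Module

variable {E : Type*} [NormedAddCommGroup E] [NormedSpace ℝ E] [FiniteDimensional ℝ E]
  [Nontrivial E] [MeasurableSpace E] [BorelSpace E]

/-- Polar coordinates for the product of a homogeneous function and a radial function. -/
theorem lintegral_homogeneous_mul_radial (μ : Measure E) [μ.IsAddHaarMeasure]
    {F : E → ENNReal} (hF : Measurable F) {a g : ℝ → ENNReal} (ha : Measurable a)
    (hFa : ∀ r : ℝ, 0 < r → ∀ x, F (r • x) = a r * F x) (hg : Measurable g) :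
    ∫⁻ x, F x * g ‖x‖ ∂μ =
      (∫⁻ θ, F θ ∂μ.toSphere) *
        ∫⁻ r in Ioi (0 : ℝ), ENNReal.ofReal (r ^ (finrank ℝ E - 1)) * (a r * g r) := by
  calc
    ∫⁻ x, F x * g ‖x‖ ∂μ = ∫⁻ x : ({(0)}ᶜ : Set E), F x.1 * g ‖x.1‖ ∂(μ.comap (↑)) := by
      rw [lintegral_subtype_comap (measurableSet_singleton _).compl fun x ↦ F x * g ‖x‖,
        restrict_compl_singleton]
    _ = ∫⁻ y, F (y.2.1 • y.1.1) * g y.2.1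
          ∂μ.toSphere.prod (.volumeIoiPow (finrank ℝ E - 1)) := by
      rw [← μ.measurePreserving_homeomorphUnitSphereProd.lintegral_comp_emb
        (Homeomorph.measurableEmbedding _)]
      refine lintegral_congr fun x => ?_
      have hx : ‖x.1‖ ≠ 0 := norm_ne_zero_iff.2 x.2
      simp [smul_smul, hx]
    _ = ∫⁻ y, F y.1.1 * (a y.2.1 * g y.2.1)
          ∂μ.toSphere.prod (.volumeIoiPow (finrank ℝ E - 1)) := by
      refine lintegral_congr fun y => ?_
      rw [hFa _ y.2.2]
      ring
    _ = (∫⁻ θ, F θ ∂μ.toSphere) *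
          ∫⁻ r : Ioi (0 : ℝ), a r * g r ∂.volumeIoiPow (finrank ℝ E - 1) :=
      lintegral_prod_mul (f := fun θ : Metric.sphere (0 : E) 1 => F θ)
        (g := fun r : Ioi (0 : ℝ) => a r * g r) (by fun_prop) (by fun_prop)
    _ = _ := by
      congr 1
      rw [Measure.volumeIoiPow, lintegral_withDensity_eq_lintegral_mul _ (by fun_prop)
        (by fun_prop), ← lintegral_subtype_comap measurableSet_Ioi]
      rfl

end Polar

theorem radialConstant_pos {d : ℕ} (hd : 0 < d) : 0 < radialConstant d := by
  have : (0 : ℝ) < d := by exact_mod_cast hd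
  exact div_pos (Real.rpow_pos_of_pos Real.pi_pos _) (Real.Gamma_pos_of_pos (by positivity))

/-- A generator is Borel only on `[0, ∞)` and arbitrary elsewhere, so compositions must pass through
the subtype. -/
theorem measurable_comp_of_nonneg {α : Type*} [MeasurableSpace α] {h : ℝ → ℝ}
    (hh : Measurable fun t : Set.Ici (0 : ℝ) => h t) {q : α → ℝ} (hq : Measurable q)
    (hq0 : ∀ x, 0 ≤ q x) : Measurable fun x => h (q x) :=
  hh.comp (hq.subtype_mk (h := fun x => hq0 x))

/-- Substitution `t = r²`; the Jacobian `2r` accounts for the factor 2. Finiteness matters because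
the Bochner integral inside `modularMoment` is 0 when it diverges. -/
theorem lintegral_radial {d : ℕ} (hd : 0 < d) {h : ℝ → ℝ} (h0 : ∀ t, 0 ≤ t → 0 ≤ h t) (k : ℤ)
    (hk : FiniteModularMoment d h k) :
    ∫⁻ r in Set.Ioi (0 : ℝ), ENNReal.ofReal (r ^ (d - 1)) *
        (ENNReal.ofReal (r ^ (2 * k)) * ENNReal.ofReal (h (r ^ 2))) =
      ENNReal.ofReal (modularMoment d h k / (2 * radialConstant d)) := by
  have hc := radialConstant_pos hd
  have e1 : ∀ r ∈ Set.Ioi (0 : ℝ), ENNReal.ofReal (r ^ (d - 1)) *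
        (ENNReal.ofReal (r ^ (2 * k)) * ENNReal.ofReal (h (r ^ 2))) =
      ENNReal.ofReal (1 / 2 * ((|(2 : ℝ)| * r ^ ((2 : ℝ) - 1)) •
        (h (r ^ (2 : ℝ)) * (r ^ (2 : ℝ)) ^ ((d : ℝ) / 2 + (k : ℝ) - 1)))) := by
    intro r hr
    have hr : 0 < r := hr
    rw [← ENNReal.ofReal_mul (by positivity), ← ENNReal.ofReal_mul (by positivity)]
    congr 1
    rw [← Real.rpow_mul hr.le, smul_eq_mul]
    have : r ^ (2 : ℝ) = r ^ 2 := by norm_cast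
    rw [this]
    have e2 : r ^ (d - 1) * r ^ (2 * k) =
        r ^ ((2 : ℝ) - 1) * r ^ (2 * ((d : ℝ) / 2 + (k : ℝ) - 1)) := by
      rw [← Real.rpow_natCast, ← Real.rpow_intCast, ← Real.rpow_add hr, ← Real.rpow_add hr]
      congr 1
      push_cast [Nat.cast_sub (show 1 ≤ d from hd)]
      ring
    rw [← mul_assoc, e2, abs_of_pos two_pos]
    ring
  rw [setLIntegral_congr_fun measurableSet_Ioi e1, ← ofReal_integral_eq_lintegral_ofReal]
  · congr 1
    rw [integral_const_mul, integral_comp_rpow_Ioi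
      (fun t => h t * t ^ ((d : ℝ) / 2 + (k : ℝ) - 1)) two_ne_zero, modularMoment]
    field_simp
  · refine Integrable.const_mul ?_ _
    exact (integrableOn_Ioi_comp_rpow_iff
      (fun t => h t * t ^ ((d : ℝ) / 2 + (k : ℝ) - 1)) two_ne_zero).2 hk
  · refine (ae_restrict_mem measurableSet_Ioi).mono fun r hr => ?_
    have hr : 0 < r := hr
    have := h0 (r ^ (2 : ℝ)) (by positivity)
    simp only [Pi.zero_apply, smul_eq_mul]
    positivity

section Transfer

open Module

variable {E : Type*} [NormedAddCommGroup E] [InnerProductSpace ℝ E] [FiniteDimensional ℝ E]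
  [Nontrivial E] [MeasurableSpace E] [BorelSpace E]

/-- The integral of a homogeneous function against an elliptical density depends on the density
generator only through a modular moment. -/
theorem lintegral_homogeneous_mul_generator {F : E → ENNReal} (hF : Measurable F) (k : ℤ)
    (hFk : ∀ r : ℝ, 0 < r → ∀ x, F (r • x) = ENNReal.ofReal (r ^ (2 * k)) * F x)
    {h : ℝ → ℝ} (hh : Measurable fun t : Set.Ici (0 : ℝ) => h t) (h0 : ∀ t, 0 ≤ t → 0 ≤ h t)
    (hk : FiniteModularMoment (finrank ℝ E) h k) :
    ∫⁻ x : E, F x * ENNReal.ofReal (h (‖x‖ ^ 2)) =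
      (∫⁻ θ, F θ ∂(volume : Measure E).toSphere) *
        ENNReal.ofReal (modularMoment (finrank ℝ E) h k / (2 * radialConstant (finrank ℝ E))) := by
  rw [← lintegral_radial finrank_pos h0 k hk]
  refine lintegral_homogeneous_mul_radial volume hF (a := fun r => ENNReal.ofReal (r ^ (2 * k)))
    (g := fun r => ENNReal.ofReal (h (r ^ 2))) ?_ hFk ?_
  · exact (measurable_id.pow_const (2 * k)).ennreal_ofReal
  · exact (measurable_comp_of_nonneg hh (by fun_prop) fun r => sq_nonneg r).ennreal_ofReal

end Transfer

/-! ### Modular moments of the Gaussian generator -/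

/-- The density generator of the standard Gaussian distribution in dimension `d`. -/
noncomputable def gaussianGenerator (d : ℕ) (t : ℝ) : ℝ :=
  (2 * Real.pi) ^ (-(d : ℝ) / 2) * Real.exp (-t / 2)

theorem gaussianGenerator_nonneg (d : ℕ) (t : ℝ) : 0 ≤ gaussianGenerator d t := by
  unfold gaussianGenerator
  have := Real.pi_pos
  positivity

theorem measurable_gaussianGenerator (d : ℕ) : Measurable (gaussianGenerator d) := by
  unfold gaussianGenerator
  fun_prop

theorem finiteModularMoment_gaussianGenerator {d : ℕ} {k : ℤ} (hk : 0 < (d : ℝ) / 2 + k) :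
    FiniteModularMoment d (gaussianGenerator d) k := by
  have := (integrableOn_rpow_mul_exp_neg_mul_rpow (p := 1) (s := (d : ℝ) / 2 + k - 1) (b := 1 / 2)
    (by linarith) one_pos (by norm_num)).const_mul ((2 * Real.pi) ^ (-(d : ℝ) / 2))
  refine (integrableOn_congr_fun (fun t _ => ?_) measurableSet_Ioi).1 this
  simp only [gaussianGenerator, Real.rpow_one]
  rw [show -(1 / 2) * t = -t / 2 by ring]
  ring

theorem modularMoment_gaussianGenerator {d : ℕ} {k : ℤ} (hk : 0 < (d : ℝ) / 2 + k) :
    modularMoment d (gaussianGenerator d) k =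
      2 ^ k * Real.Gamma ((d : ℝ) / 2 + k) / Real.Gamma ((d : ℝ) / 2) := by
  have e : ∫ t in Set.Ioi (0 : ℝ), gaussianGenerator d t * t ^ ((d : ℝ) / 2 + (k : ℝ) - 1) =
      (2 * Real.pi) ^ (-(d : ℝ) / 2) *
        ∫ t in Set.Ioi (0 : ℝ), t ^ ((d : ℝ) / 2 + (k : ℝ) - 1) * Real.exp (-(1 / 2) * t) := by
    rw [← integral_const_mul]
    refine setIntegral_congr_fun measurableSet_Ioi fun t _ => ?_
    simp only [gaussianGenerator]
    rw [show -(1 / 2) * t = -t / 2 by ring]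
    ring
  have e2 := Real.integral_rpow_mul_exp_neg_mul_Ioi hk (r := 1 / 2) (by norm_num)
  simp only [← neg_mul] at e2
  rw [modularMoment, e, e2, radialConstant, Real.mul_rpow two_pos.le Real.pi_pos.le,
    show (1 / (1 / 2) : ℝ) = 2 by norm_num, Real.rpow_add two_pos, Real.rpow_intCast,
    neg_div, Real.rpow_neg two_pos.le, Real.rpow_neg Real.pi_pos.le]
  have h1 : Real.pi ^ ((d : ℝ) / 2) ≠ 0 := (Real.rpow_pos_of_pos Real.pi_pos _).ne'
  have h2 : (2 : ℝ) ^ ((d : ℝ) / 2) ≠ 0 := (Real.rpow_pos_of_pos two_pos _).ne'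
  field_simp

theorem modularMoment_gaussianGenerator_zero {d : ℕ} (hd : 0 < d) :
    modularMoment d (gaussianGenerator d) 0 = 1 := by
  have : (0 : ℝ) < d := by exact_mod_cast hd
  rw [modularMoment_gaussianGenerator (by push_cast; linarith)]
  have := (Real.Gamma_pos_of_pos (half_pos this)).ne'
  simp [this]

/-- The mean of the reciprocal of a chi-square variable with `d` degrees of freedom, from the
functional equation of Gamma. -/
theorem modularMoment_gaussianGenerator_neg_one {d : ℕ} (hd : 2 < d) :
    modularMoment d (gaussianGenerator d) (-1) = 1 / ((d : ℝ) - 2) := by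
  have : (2 : ℝ) < d := by exact_mod_cast hd
  rw [modularMoment_gaussianGenerator (by push_cast; linarith)]
  have h1 := Real.Gamma_add_one (s := (d : ℝ) / 2 - 1) (by linarith)
  have h2 : 0 < Real.Gamma ((d : ℝ) / 2 - 1) := Real.Gamma_pos_of_pos (by linarith)
  rw [sub_add_cancel] at h1
  have h3 : (d : ℝ) - 2 ≠ 0 := by linarith
  have h4 : (d : ℝ) / 2 - 1 ≠ 0 := by linarith
  rw [h1]
  push_cast
  rw [← sub_eq_add_neg]
  generalize Real.Gamma _ = g at h2
  field_simp

theorem modularMoment_gaussianGenerator_neg_two {d : ℕ} (hd : 4 < d) :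
    modularMoment d (gaussianGenerator d) (-2) = 1 / (((d : ℝ) - 2) * ((d : ℝ) - 4)) := by
  have : (4 : ℝ) < d := by exact_mod_cast hd
  rw [modularMoment_gaussianGenerator (by push_cast; linarith)]
  have h1 := Real.Gamma_add_one (s := (d : ℝ) / 2 - 1) (by linarith)
  have h1' := Real.Gamma_add_one (s := (d : ℝ) / 2 - 2) (by linarith)
  have h2 : 0 < Real.Gamma ((d : ℝ) / 2 - 2) := Real.Gamma_pos_of_pos (by linarith)
  rw [sub_add_cancel] at h1
  rw [show (d : ℝ) / 2 - 2 + 1 = d / 2 - 1 by ring] at h1'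
  have h3 : (d : ℝ) - 2 ≠ 0 := by linarith
  have h5 : (d : ℝ) - 4 ≠ 0 := by linarith
  have h4 : (d : ℝ) / 2 - 1 ≠ 0 := by linarith
  have h4' : (d : ℝ) / 2 - 2 ≠ 0 := by linarith
  rw [h1, h1']
  push_cast
  rw [← sub_eq_add_neg]
  generalize Real.Gamma _ = g at h2
  field_simp
  norm_num [h5]

/-! ### Standard Gaussian measures: density, norms, projections -/

section Gaussian

open Module

variable {E : Type*} [NormedAddCommGroup E] [InnerProductSpace ℝ E] [FiniteDimensional ℝ E]
  [MeasurableSpace E] [BorelSpace E]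

/-- Both measures are finite and have the same characteristic function, by the Gaussian Fourier
integral. -/
theorem stdGaussian_eq_withDensity :
    stdGaussian E = (volume : Measure E).withDensity fun x =>
      ENNReal.ofReal (gaussianGenerator (finrank ℝ E) (‖x‖ ^ 2)) := by
  have hmeas : Measurable fun x : E => gaussianGenerator (finrank ℝ E) (‖x‖ ^ 2) :=
    (measurable_gaussianGenerator _).comp (by fun_prop)
  have hint : Integrable fun x : E => gaussianGenerator (finrank ℝ E) (‖x‖ ^ 2) := by
    have := (GaussianFourier.integrable_cexp_neg_mul_sq_norm_add (V := E) (b := 1 / 2)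
      (by norm_num) 0 0).norm.const_mul ((2 * Real.pi) ^ (-(finrank ℝ E : ℝ) / 2))
    refine this.congr (ae_of_all _ fun x => ?_)
    simp only [gaussianGenerator, Complex.norm_exp]
    congr 2
    rw [zero_mul, add_zero, show -(1 / 2 : ℂ) * (‖x‖ : ℂ) ^ 2 = ((-‖x‖ ^ 2 / 2 : ℝ) : ℂ) by
      push_cast; ring, Complex.ofReal_re]
  have : IsFiniteMeasure ((volume : Measure E).withDensity fun x =>
      ENNReal.ofReal (gaussianGenerator (finrank ℝ E) (‖x‖ ^ 2))) :=
    isFiniteMeasure_withDensity_ofReal hint.2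
  refine Measure.ext_of_charFun ?_
  ext t
  rw [charFun_stdGaussian, charFun_apply, integral_withDensity_eq_integral_toReal_smul
    hmeas.ennreal_ofReal (ae_of_all _ fun _ => ENNReal.ofReal_lt_top)]
  have e : ∀ x : E, (ENNReal.ofReal (gaussianGenerator (finrank ℝ E) (‖x‖ ^ 2))).toReal •
      Complex.exp (inner ℝ x t * Complex.I) =
      (((2 * Real.pi) ^ (-(finrank ℝ E : ℝ) / 2) : ℝ) : ℂ) *
        Complex.exp (-(1 / 2) * (‖x‖ : ℂ) ^ 2 + Complex.I * inner ℝ t x) := by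
    intro x
    rw [ENNReal.toReal_ofReal (gaussianGenerator_nonneg _ _), gaussianGenerator,
      Complex.real_smul, Complex.exp_add, real_inner_comm t x]
    push_cast
    rw [show -(‖x‖ : ℂ) ^ 2 / 2 = -(1 / 2) * (‖x‖ : ℂ) ^ 2 by ring, mul_comm Complex.I]
    ring
  simp_rw [e]
  rw [integral_const_mul, GaussianFourier.integral_cexp_neg_mul_sq_norm_add (by norm_num)]
  have e2 : ((Real.pi : ℂ) / (1 / 2)) ^ ((finrank ℝ E : ℂ) / 2) =
      (((2 * Real.pi) ^ ((finrank ℝ E : ℝ) / 2) : ℝ) : ℂ) := by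
    rw [Complex.ofReal_cpow (by positivity)]
    push_cast
    congr 1
    ring
  rw [e2, ← mul_assoc, ← Complex.ofReal_mul, ← Real.rpow_add (by positivity)]
  rw [neg_div (_ : ℝ) (finrank ℝ E : ℝ), neg_add_cancel, Real.rpow_zero, Complex.I_sq]
  push_cast
  rw [one_mul]
  congr 1
  ring

theorem lintegral_norm_zpow_stdGaussian [Nontrivial E] {k : ℤ}
    (hk : 0 < (finrank ℝ E : ℝ) / 2 + k) :
    ∫⁻ x, ENNReal.ofReal (‖x‖ ^ (2 * k)) ∂stdGaussian E =
      ENNReal.ofReal (modularMoment (finrank ℝ E) (gaussianGenerator (finrank ℝ E)) k) := by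
  have hmeas : Measurable fun x : E => ENNReal.ofReal (gaussianGenerator (finrank ℝ E) (‖x‖ ^ 2)) :=
    ((measurable_gaussianGenerator _).comp (by fun_prop)).ennreal_ofReal
  have hc := radialConstant_pos (finrank_pos (R := ℝ) (M := E))
  have key : ∀ j : ℤ, 0 < (finrank ℝ E : ℝ) / 2 + j →
      ∫⁻ x, ENNReal.ofReal (‖x‖ ^ (2 * j)) ∂stdGaussian E =
        (volume : Measure E).toSphere Set.univ * ENNReal.ofReal (modularMoment (finrank ℝ E)
          (gaussianGenerator (finrank ℝ E)) j / (2 * radialConstant (finrank ℝ E))) := by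
    intro j hj
    have hF : Measurable fun x : E => ENNReal.ofReal (‖x‖ ^ (2 * j)) :=
      (measurable_norm.pow_const (2 * j)).ennreal_ofReal
    rw [stdGaussian_eq_withDensity, lintegral_withDensity_eq_lintegral_mul _ hmeas hF]
    simp only [Pi.mul_apply, mul_comm (ENNReal.ofReal (gaussianGenerator _ _))]
    rw [lintegral_homogeneous_mul_generator hF j ?_
      ((measurable_gaussianGenerator _).comp measurable_subtype_coe)
      (fun t _ => gaussianGenerator_nonneg _ t) (finiteModularMoment_gaussianGenerator hj)]
    · congr 1
      simp
    · intro r hr x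
      rw [norm_smul, mul_zpow, ENNReal.ofReal_mul (by positivity), Real.norm_of_nonneg hr.le]
  -- The case `k = 0`, where both the integral and the modular moment are 1, determines the area of
  -- the sphere, so it is never computed.
  have h0 := key 0 (by have := finrank_pos (R := ℝ) (M := E); push_cast; positivity)
  rw [modularMoment_gaussianGenerator_zero finrank_pos] at h0
  simp only [mul_zero, zpow_zero, ENNReal.ofReal_one, lintegral_const, measure_univ, mul_one] at h0
  rw [key k hk, div_eq_mul_one_div, mul_comm (modularMoment _ _ _),
    ENNReal.ofReal_mul (by positivity), ← mul_assoc, ← h0, one_mul]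

/-- For `t` in `V`, pairing `t` with the projection of `x` is pairing it with `x`, so the two
characteristic functions agree on `V`. -/
theorem map_orthogonalProjectionOnto_stdGaussian (V : Submodule ℝ E) :
    (stdGaussian E).map V.orthogonalProjectionOnto = stdGaussian V := by
  refine Measure.ext_of_charFun ?_
  ext t
  rw [charFun_stdGaussian, charFun_apply, integral_map (by fun_prop) (by fun_prop)]
  have := charFun_stdGaussian (t : E)
  rw [charFun_apply] at this
  simpa using this

theorem lintegral_norm_orthogonalProjectionOnto_stdGaussian (V : Submodule ℝ E) {k : ℤ}
    (hk : 0 < (finrank ℝ V : ℝ) / 2 + k) (hV : 0 < finrank ℝ V) :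
    ∫⁻ x, ENNReal.ofReal (‖V.orthogonalProjectionOnto x‖ ^ (2 * k)) ∂stdGaussian E =
      ENNReal.ofReal (modularMoment (finrank ℝ V) (gaussianGenerator (finrank ℝ V)) k) := by
  have := Module.nontrivial_of_finrank_pos hV
  rw [← lintegral_norm_zpow_stdGaussian hk, ← map_orthogonalProjectionOnto_stdGaussian V,
    lintegral_map (measurable_norm.pow_const (2 * k)).ennreal_ofReal (by fun_prop)]

end Gaussian

/-! ### Measurability of matrix operations -/

section Measurability

variable {m n : Type*}

instance instBorelSpaceMatrix [Countable m] [Countable n] : BorelSpace (Matrix m n ℝ) :=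
  inferInstanceAs (BorelSpace (m → n → ℝ))

theorem measurable_matrix_entry (i : m) (j : n) : Measurable fun A : Matrix m n ℝ => A i j :=
  (measurable_pi_apply j).comp (measurable_pi_apply (X := fun _ : m => n → ℝ) i)

theorem measurable_matrix_inv_entry [Fintype m] [DecidableEq m] (i j : m) :
    Measurable fun A : Matrix m m ℝ => A⁻¹ i j := by
  have h1 : Measurable fun A : Matrix m m ℝ => A.det := continuous_id.matrix_det.measurable
  have h2 : Measurable fun A : Matrix m m ℝ => A.adjugate i j :=
    (continuous_id.matrix_adjugate.matrix_elem i j).measurable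
  simp only [Matrix.inv_def, Ring.inverse_eq_inv', Matrix.smul_apply, smul_eq_mul]
  exact h1.inv.mul h2

theorem measurable_matrix_inv [Fintype m] [DecidableEq m] :
    Measurable fun A : Matrix m m ℝ => A⁻¹ :=
  measurable_pi_lambda _ fun i => measurable_pi_lambda _ fun j => measurable_matrix_inv_entry i j

end Measurability

/-! ### Entries of an inverse Gram matrix as reciprocal squared distances -/

section Gram

open Module Submodule

variable {ι H : Type*} [Fintype ι] [DecidableEq ι] [NormedAddCommGroup H] [InnerProductSpace ℝ H]

/-- The rows of the inverse Gram matrix are the coordinates of the dual basis. -/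
theorem inner_sum_inv_gram {x : ι → H} (hx : LinearIndependent ℝ x) (i k : ι) :
    inner ℝ (x k) (∑ l, (Matrix.gram ℝ x)⁻¹ i l • x l) = if i = k then 1 else 0 := by
  have hdet : IsUnit (Matrix.gram ℝ x).det :=
    isUnit_iff_ne_zero.2 (Matrix.det_gram_ne_zero_iff_linearIndependent.2 hx)
  have := congrFun (congrFun (Matrix.nonsing_inv_mul _ hdet) i) k
  rw [Matrix.one_apply] at this
  rw [← this, Matrix.mul_apply, inner_sum]
  refine Finset.sum_congr rfl fun l _ => ?_
  rw [inner_smul_right, Matrix.gram_apply, real_inner_comm]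

theorem inv_gram_symm (x : ι → H) (i j : ι) :
    (Matrix.gram ℝ x)⁻¹ i j = (Matrix.gram ℝ x)⁻¹ j i := by
  have := (Matrix.isHermitian_gram ℝ x).inv.apply i j
  simpa using this.symm

variable [FiniteDimensional ℝ H]

/-- Let `V` be the span of the `x k`, `k ∈ s`, and `P` the projection onto its orthogonal
complement. The vector `y = ∑ c l • x l` is orthogonal to `V` and congruent to `c j • x j` modulo
`V`, so `y = c j • P (x j)`; pairing with `x j` gives `1 = c j * ‖P (x j)‖²`. -/
theorem coeff_mul_norm_sq_orthogonalProjectionOnto {x : ι → H} {c : ι → ℝ} {s : Set ι} {j : ι}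
    (hc : ∀ k ∉ s, k ≠ j → c k = 0) (h0 : ∀ k ∈ s, inner ℝ (x k) (∑ l, c l • x l) = 0)
    (h1 : inner ℝ (x j) (∑ l, c l • x l) = 1) :
    c j * ‖(span ℝ (x '' s))ᗮ.orthogonalProjectionOnto (x j)‖ ^ 2 = 1 := by
  set V := span ℝ (x '' s)
  have hy : ∑ l, c l • x l ∈ Vᗮ := by
    refine (Submodule.mem_orthogonal _ _).2 fun u hu => ?_
    induction hu using Submodule.span_induction with
    | mem u hu => obtain ⟨k, hk, rfl⟩ := hu; exact h0 k hk
    | zero => simp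
    | add u v _ _ hu hv => rw [inner_add_left, hu, hv, add_zero]
    | smul a u _ hu => rw [inner_smul_left, hu, mul_zero]
  have hv : ∑ l, c l • x l - c j • x j ∈ V := by
    rw [← Finset.add_sum_erase _ _ (Finset.mem_univ j), add_sub_cancel_left]
    refine Submodule.sum_mem _ fun k hk => ?_
    by_cases hks : k ∈ s
    · exact V.smul_mem _ (subset_span ⟨k, hks, rfl⟩)
    · rw [hc k hks (Finset.ne_of_mem_erase hk), zero_smul]
      exact V.zero_mem
  have e1 : Vᗮ.orthogonalProjectionOnto (∑ l, c l • x l - c j • x j) = 0 :=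
    orthogonalProjectionOnto_orthogonal_apply_eq_zero hv
  have e2 : ((Vᗮ.orthogonalProjectionOnto (∑ l, c l • x l) : Vᗮ) : H) = ∑ l, c l • x l :=
    congrArg Subtype.val (orthogonalProjectionOnto_mem_subspace_eq_self (K := Vᗮ) ⟨_, hy⟩)
  rw [map_sub, map_smul, sub_eq_zero] at e1
  rw [← real_inner_self_eq_norm_sq, ← inner_smul_right, ← e1,
    inner_orthogonalProjectionOnto_eq_of_mem_right, e2, h1]

theorem inv_gram_diag {x : ι → H} (hx : LinearIndependent ℝ x) (i : ι) :
    (Matrix.gram ℝ x)⁻¹ i i *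
      ‖(span ℝ (x '' {i}ᶜ))ᗮ.orthogonalProjectionOnto (x i)‖ ^ 2 = 1 := by
  refine coeff_mul_norm_sq_orthogonalProjectionOnto (c := fun l => (Matrix.gram ℝ x)⁻¹ i l)
    (fun k hk hki => absurd hki (by simpa using hk)) (fun k hk => ?_) ?_
  · rw [inner_sum_inv_gram hx, if_neg (fun h => hk h.symm)]
  · rw [inner_sum_inv_gram hx, if_pos rfl]

/-- Subtracting a multiple of the `i`-th dual vector from the `j`-th kills the coefficient of `x i`.
What remains lies in the span of the vectors other than `x i` and is dual to `x j` there, so the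
Schur complement does not depend on `x i`. -/
theorem inv_gram_schur {x : ι → H} (hx : LinearIndependent ℝ x) {i j : ι} (hij : i ≠ j) :
    ((Matrix.gram ℝ x)⁻¹ j j - (Matrix.gram ℝ x)⁻¹ i j ^ 2 / (Matrix.gram ℝ x)⁻¹ i i) *
      ‖(span ℝ (x '' {i, j}ᶜ))ᗮ.orthogonalProjectionOnto (x j)‖ ^ 2 = 1 := by
  set W := (Matrix.gram ℝ x)⁻¹ with hW
  have hii : W i i ≠ 0 := left_ne_zero_of_mul_eq_one (inv_gram_diag hx i)
  have hk : ∀ k, inner ℝ (x k) (∑ l, (W j l - W i j / W i i * W i l) • x l) =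
      (if j = k then 1 else 0) - W i j / W i i * (if i = k then 1 else 0) := by
    intro k
    rw [← inner_sum_inv_gram hx j k, ← inner_sum_inv_gram hx i k, ← inner_smul_right,
      ← inner_sub_right, Finset.smul_sum, ← Finset.sum_sub_distrib]
    simp only [sub_smul, mul_smul, ← hW]
  have := coeff_mul_norm_sq_orthogonalProjectionOnto (x := x) (s := {i, j}ᶜ) (j := j)
    (c := fun l => W j l - W i j / W i i * W i l) (fun k hk hkj => ?_) (fun k hks => ?_) ?_
  · rw [← this]
    congr 1
    ring
  · have : k = i := by simpa [hkj] using hk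
    subst this
    rw [show W j k = W k j from inv_gram_symm x j k]
    field_simp
    ring
  · have h1 : i ≠ k ∧ j ≠ k := by
      simp only [Set.mem_compl_iff, Set.mem_insert_iff, Set.mem_singleton_iff, not_or] at hks
      exact ⟨fun h => hks.1 h.symm, fun h => hks.2 h.symm⟩
    rw [hk, if_neg h1.1, if_neg h1.2]
    ring
  · rw [hk, if_pos rfl, if_neg hij]
    ring

end Gram

open Module Submodule in
theorem finrank_orthogonal_span_image {ι H : Type*} [NormedAddCommGroup H]
    [InnerProductSpace ℝ H] [FiniteDimensional ℝ H] {x : ι → H} (hx : LinearIndependent ℝ x) (s : Finset ι) :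
    finrank ℝ (span ℝ (x '' (s : Set ι)))ᗮ + s.card = finrank ℝ H := by
  have h1 := (span ℝ (x '' (s : Set ι))).finrank_add_finrank_orthogonal
  have h2 : finrank ℝ (span ℝ (x '' (s : Set ι))) = s.card := by
    have := finrank_span_eq_card (hx.comp (fun k : (s : Set ι) => (k : ι)) Subtype.val_injective)
    rw [Set.range_comp, Subtype.range_coe] at this
    simpa using this
  omega

/-! ### Fubini for a product measure, one coordinate at a time -/

section Update

variable {ι : Type*} [Fintype ι] [DecidableEq ι] {X : ι → Type*} [∀ i, MeasurableSpace (X i)]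
  (μ : ∀ i, Measure (X i)) [∀ i, IsProbabilityMeasure (μ i)]

theorem measurable_lintegral_update {ι : Type*} [DecidableEq ι] {X : ι → Type*}
    [∀ i, MeasurableSpace (X i)] (μ : ∀ i, Measure (X i)) [∀ i, IsProbabilityMeasure (μ i)]
    {f : (∀ i, X i) → ENNReal} (hf : Measurable f) (i : ι) :
    Measurable fun x => ∫⁻ y, f (Function.update x i y) ∂μ i := by
  have := hf.lmarginal μ (s := {i})
  rwa [lmarginal_singleton] at this

/-- Resampling coordinate `i` independently does not change the law. This freezes the other
coordinates without splitting the product. -/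
theorem lintegral_pi_eq_lintegral_update {f : (∀ i, X i) → ENNReal} (hf : Measurable f) (i : ι) :
    ∫⁻ x, f x ∂Measure.pi μ = ∫⁻ x, ∫⁻ y, f (Function.update x i y) ∂μ i ∂Measure.pi μ := by
  have : ∀ i, Nonempty (X i) := fun i => (μ i).nonempty_of_neZero
  let a : ∀ i, X i := fun i => Classical.arbitrary _
  have hg := measurable_lintegral_update μ hf i
  rw [lintegral_eq_lmarginal_univ a, lintegral_eq_lmarginal_univ a,
    lmarginal_erase' f hf (Finset.mem_univ i), lmarginal_erase' _ hg (Finset.mem_univ i)]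
  simp

theorem ae_pi_iff_ae_update {q : (∀ i, X i) → Prop} (hq : MeasurableSet {x | q x}) (i : ι) :
    (∀ᵐ x ∂Measure.pi μ, q x) ↔
      ∀ᵐ x ∂Measure.pi μ, ∀ᵐ y ∂μ i, q (Function.update x i y) := by
  have hm : Measurable ({x | q x}ᶜ.indicator (1 : (∀ i, X i) → ENNReal)) :=
    measurable_one.indicator hq.compl
  have hu : ∀ x : ∀ i, X i, Measurable (Function.update x i) := fun x => measurable_update x
  rw [ae_iff, ← Set.compl_ofPred, ← lintegral_indicator_one hq.compl,
    lintegral_pi_eq_lintegral_update μ hm i,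
    lintegral_eq_zero_iff (measurable_lintegral_update μ hm i)]
  refine Filter.eventually_congr (Filter.Eventually.of_forall fun x => ?_)
  have h0 := lintegral_eq_zero_iff (μ := μ i) (hm.comp (hu x))
  rw [Pi.zero_apply]
  refine h0.trans ?_
  refine Filter.eventually_congr (Filter.Eventually.of_forall fun y => ?_)
  simp

end Update

/-! ### Inverse Gram matrices of independent Gaussian vectors -/

section GaussianRows

open Module Submodule

variable {ι H : Type*} [Fintype ι] [DecidableEq ι] [NormedAddCommGroup H] [InnerProductSpace ℝ H]
  [FiniteDimensional ℝ H] [MeasurableSpace H] [BorelSpace H]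

theorem ae_notMem_stdGaussian {V : Submodule ℝ H} (hV : V ≠ ⊤) :
    ∀ᵐ y ∂stdGaussian H, y ∉ V := by
  have h : ∀ᵐ y ∂(volume : Measure H), y ∉ V := by
    rw [ae_iff]
    simpa using Measure.addHaar_submodule volume V hV
  have : stdGaussian H ≪ volume := by
    rw [stdGaussian_eq_withDensity]
    exact withDensity_absolutelyContinuous _ _
  exact this.ae_le h

theorem ae_linearIndependent_pi_stdGaussian (hcard : Fintype.card ι ≤ finrank ℝ H) :
    ∀ᵐ x ∂Measure.pi fun _ : ι => stdGaussian H, LinearIndependent ℝ x := by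
  have key : ∀ s : Finset ι,
      ∀ᵐ x ∂Measure.pi fun _ : ι => stdGaussian H, LinearIndepOn ℝ x (s : Set ι) := by
    intro s
    induction s using Finset.induction_on with
    | empty => simp
    | insert i s his ih =>
      refine (ae_pi_iff_ae_update _ ?_ i).2 ?_
      · have h1 : IsOpen {f : ((insert i s : Finset ι) : Set ι) → H | LinearIndependent ℝ f} :=
          isOpen_setOfPred_linearIndependent
        exact h1.measurableSet.preimage (f := fun (x : ι → H)
          (j : ((insert i s : Finset ι) : Set ι)) => x j) (by fun_prop)
      · filter_upwards [ih] with x hx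
        -- Fewer than `finrank ℝ H` vectors span a proper subspace, which a fresh Gaussian vector
        -- almost surely avoids.
        have hspan : span ℝ (x '' (s : Set ι)) ≠ ⊤ := by
          intro htop
          classical
          have h2 := (finrank_span_finset_le_card (R := ℝ) (s.image x)).trans Finset.card_image_le
          rw [Set.finrank, Finset.coe_image, htop, finrank_top] at h2
          have h4 := Finset.card_le_univ (insert i s)
          rw [Finset.card_insert_of_notMem his] at h4
          omega
        filter_upwards [ae_notMem_stdGaussian hspan] with y hy
        have hs : Set.EqOn (Function.update x i y) x (s : Set ι) := fun k hk =>
          Function.update_of_ne (fun h : k = i => his (h ▸ Finset.mem_coe.1 hk)) _ _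
        rw [Finset.coe_insert, linearIndepOn_insert (by simpa using his), hs.image_eq]
        exact ⟨(linearIndepOn_congr hs).2 hx, by simpa using hy⟩
  filter_upwards [key Finset.univ] with x hx
  simpa using hx

theorem measurable_inv_gram (i j : ι) :
    Measurable fun x : ι → H => (Matrix.gram ℝ x)⁻¹ i j := by
  have : Measurable fun x : ι → H => Matrix.gram ℝ x :=
    measurable_pi_lambda _ fun i => measurable_pi_lambda _ fun j => by
      simp only [Matrix.gram_apply]
      fun_prop
  exact (measurable_matrix_inv_entry i j).comp this

theorem ae_linearIndependent_update (hcard : Fintype.card ι ≤ finrank ℝ H) (i : ι) :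
    ∀ᵐ x ∂Measure.pi fun _ : ι => stdGaussian H,
      ∀ᵐ y ∂stdGaussian H, LinearIndependent ℝ (Function.update x i y) :=
  (ae_pi_iff_ae_update (fun _ : ι => stdGaussian H)
    (isOpen_setOfPred_linearIndependent.measurableSet) i).1
    (ae_linearIndependent_pi_stdGaussian hcard)

theorem zpow_two_mul_neg_of_mul_sq_eq_one {a b : ℝ} (h : a * b ^ 2 = 1) (m : ℕ) :
    a ^ m = b ^ (2 * (-(m : ℤ))) := by
  rw [zpow_mul, zpow_neg, eq_inv_of_mul_eq_one_left h]
  norm_cast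
  rw [inv_pow]

/-- With the other vectors frozen, the diagonal entry is the reciprocal squared norm of a standard
Gaussian vector in the orthogonal complement of their span. `D` is the dimension of that complement,
and `2 * m < D` is the convergence condition at the origin. -/
theorem lintegral_inv_gram_diag (i : ι) {m D : ℕ} (hD : D + Fintype.card ι = finrank ℝ H + 1)
    (hm : 2 * m < D) :
    ∫⁻ x, ENNReal.ofReal ((Matrix.gram ℝ x)⁻¹ i i ^ m) ∂Measure.pi (fun _ : ι => stdGaussian H) =
      ENNReal.ofReal (modularMoment D (gaussianGenerator D) (-m)) := by
  have hcard : Fintype.card ι ≤ finrank ℝ H := by omega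
  rw [lintegral_pi_eq_lintegral_update _ ((measurable_inv_gram i i).pow_const m).ennreal_ofReal i]
  have key : ∀ᵐ x ∂Measure.pi fun _ : ι => stdGaussian H,
      ∫⁻ y, ENNReal.ofReal ((Matrix.gram ℝ (Function.update x i y))⁻¹ i i ^ m) ∂stdGaussian H =
        ENNReal.ofReal (modularMoment D (gaussianGenerator D) (-m)) := by
    filter_upwards [ae_linearIndependent_pi_stdGaussian hcard,
      ae_linearIndependent_update hcard i] with x hx hxy
    have hfin : finrank ℝ (span ℝ (x '' {i}ᶜ))ᗮ = D := by
      have h1 := finrank_orthogonal_span_image hx {i}ᶜ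
      have h2 := Finset.card_compl_add_card ({i} : Finset ι)
      rw [Finset.coe_compl, Finset.coe_singleton] at h1
      rw [Finset.card_singleton] at h2
      omega
    have hm' : (2 * m : ℝ) < D := by exact_mod_cast hm
    rw [← hfin, ← lintegral_norm_orthogonalProjectionOnto_stdGaussian _ _ (by omega)]
    · refine lintegral_congr_ae ?_
      filter_upwards [hxy] with y hy
      have h1 := inv_gram_diag hy i
      rw [(Set.image_congr fun k hk => Function.update_of_ne hk _ _ :
        Function.update x i y '' {i}ᶜ = x '' {i}ᶜ), Function.update_self] at h1
      rw [zpow_two_mul_neg_of_mul_sq_eq_one h1]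
    · rw [hfin]
      push_cast
      linarith
  rw [lintegral_congr_ae key]
  simp

/-- The minor factors as the diagonal entry at `i` times the Schur complement `c`, which is free of
`x i`. Integrating over `x i` first leaves `c`; integrating `c` over `x j` then involves the
complement of the span of two fewer vectors than the whole family, whence `D + 1`. -/
theorem lintegral_inv_gram_minor {i j : ι} (hij : i ≠ j) {D : ℕ}
    (hD : D + Fintype.card ι = finrank ℝ H + 1) (hm : 2 < D) :
    ∫⁻ x, ENNReal.ofReal ((Matrix.gram ℝ x)⁻¹ i i * (Matrix.gram ℝ x)⁻¹ j j -
        (Matrix.gram ℝ x)⁻¹ i j ^ 2) ∂Measure.pi (fun _ : ι => stdGaussian H) =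
      ENNReal.ofReal (modularMoment D (gaussianGenerator D) (-1)) *
        ENNReal.ofReal (modularMoment (D + 1) (gaussianGenerator (D + 1)) (-1)) := by
  have hcard : Fintype.card ι ≤ finrank ℝ H := by omega
  have hm' : (2 : ℝ) < D := by exact_mod_cast hm
  let c : (ι → H) → ℝ := fun x =>
    (Matrix.gram ℝ x)⁻¹ j j - (Matrix.gram ℝ x)⁻¹ i j ^ 2 / (Matrix.gram ℝ x)⁻¹ i i
  have hcm : Measurable c := (measurable_inv_gram j j).sub
    (((measurable_inv_gram i j).pow_const 2).div (measurable_inv_gram i i))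
  have hc : ∀ x, LinearIndependent ℝ x →
      c x * ‖(span ℝ (x '' {i, j}ᶜ))ᗮ.orthogonalProjectionOnto (x j)‖ ^ 2 = 1 :=
    fun x hx => inv_gram_schur hx hij
  have hminor : ∀ x, LinearIndependent ℝ x → (Matrix.gram ℝ x)⁻¹ i i * (Matrix.gram ℝ x)⁻¹ j j -
      (Matrix.gram ℝ x)⁻¹ i j ^ 2 = (Matrix.gram ℝ x)⁻¹ i i * c x := by
    intro x hx
    have : (Matrix.gram ℝ x)⁻¹ i i ≠ 0 := left_ne_zero_of_mul_eq_one (inv_gram_diag hx i)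
    simp only [c]
    field_simp
  have step1 : ∀ᵐ x ∂Measure.pi fun _ : ι => stdGaussian H,
      ∫⁻ y, ENNReal.ofReal ((Matrix.gram ℝ (Function.update x i y))⁻¹ i i *
        (Matrix.gram ℝ (Function.update x i y))⁻¹ j j -
          (Matrix.gram ℝ (Function.update x i y))⁻¹ i j ^ 2) ∂stdGaussian H =
        ENNReal.ofReal (modularMoment D (gaussianGenerator D) (-1)) * ENNReal.ofReal (c x) := by
    filter_upwards [ae_linearIndependent_pi_stdGaussian hcard,
      ae_linearIndependent_update hcard i] with x hx hxy
    have hfin : finrank ℝ (span ℝ (x '' {i}ᶜ))ᗮ = D := by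
      have h1 := finrank_orthogonal_span_image hx {i}ᶜ
      have h2 := Finset.card_compl_add_card ({i} : Finset ι)
      rw [Finset.coe_compl, Finset.coe_singleton] at h1
      rw [Finset.card_singleton] at h2
      omega
    rw [← hfin, ← lintegral_norm_orthogonalProjectionOnto_stdGaussian _ _ (by omega),
      ← lintegral_mul_const _ (by
        exact ((Measurable.norm (by fun_prop)).pow_const (2 * (-1 : ℤ))).ennreal_ofReal)]
    · refine lintegral_congr_ae ?_
      filter_upwards [hxy] with y hy
      have h1 := inv_gram_diag hy i
      rw [(Set.image_congr fun k hk => Function.update_of_ne hk _ _ :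
        Function.update x i y '' {i}ᶜ = x '' {i}ᶜ), Function.update_self] at h1
      have h2 := hc _ hy
      rw [(Set.image_congr fun k hk => Function.update_of_ne
          (fun h : k = i => hk (Or.inl h)) _ _ :
        Function.update x i y '' {i, j}ᶜ = x '' {i, j}ᶜ), Function.update_of_ne hij.symm] at h2
      -- Both values are inverse to the same squared norm, that of the projection of `x j`,
      -- unaffected by the change of `x i`.
      have h3 : c (Function.update x i y) = c x :=
        mul_right_cancel₀ (right_ne_zero_of_mul_eq_one h2) (h2.trans (hc x hx).symm)
      have h4 := zpow_two_mul_neg_of_mul_sq_eq_one h1 1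
      rw [hminor _ hy, h3, ← pow_one ((Matrix.gram ℝ _)⁻¹ i i), h4,
        ENNReal.ofReal_mul (by positivity), Nat.cast_one]
    · rw [hfin]
      push_cast
      linarith
  have step2 : ∀ᵐ x ∂Measure.pi fun _ : ι => stdGaussian H,
      ∫⁻ y, ENNReal.ofReal (c (Function.update x j y)) ∂stdGaussian H =
        ENNReal.ofReal (modularMoment (D + 1) (gaussianGenerator (D + 1)) (-1)) := by
    filter_upwards [ae_linearIndependent_pi_stdGaussian hcard,
      ae_linearIndependent_update hcard j] with x hx hxy
    have hfin : finrank ℝ (span ℝ (x '' {i, j}ᶜ))ᗮ = D + 1 := by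
      have h1 := finrank_orthogonal_span_image hx {i, j}ᶜ
      have h2 := Finset.card_compl_add_card ({i, j} : Finset ι)
      rw [Finset.coe_compl, Finset.coe_pair] at h1
      rw [Finset.card_pair hij] at h2
      omega
    rw [← hfin, ← lintegral_norm_orthogonalProjectionOnto_stdGaussian _ _ (by omega)]
    · refine lintegral_congr_ae ?_
      filter_upwards [hxy] with y hy
      have h2 := hc _ hy
      rw [(Set.image_congr fun k hk => Function.update_of_ne
          (fun h : k = j => hk (Or.inr h)) _ _ :
        Function.update x j y '' {i, j}ᶜ = x '' {i, j}ᶜ), Function.update_self] at h2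
      have h4 := zpow_two_mul_neg_of_mul_sq_eq_one h2 1
      rw [← pow_one (c _), h4, Nat.cast_one]
    · rw [hfin]
      push_cast
      linarith
  have hmeas : Measurable fun x : ι → H => ENNReal.ofReal ((Matrix.gram ℝ x)⁻¹ i i *
      (Matrix.gram ℝ x)⁻¹ j j - (Matrix.gram ℝ x)⁻¹ i j ^ 2) :=
    (((measurable_inv_gram i i).mul (measurable_inv_gram j j)).sub
      ((measurable_inv_gram i j).pow_const 2)).ennreal_ofReal
  rw [lintegral_pi_eq_lintegral_update _ hmeas i, lintegral_congr_ae step1,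
    lintegral_const_mul _ hcm.ennreal_ofReal,
    lintegral_pi_eq_lintegral_update _ hcm.ennreal_ofReal j, lintegral_congr_ae step2]
  simp

end GaussianRows

/-! ### From Gaussian vectors to the rows of a Gaussian matrix -/

section GaussianMatrix

variable {ι κ : Type*} [Fintype ι] [Fintype κ]

theorem map_toLp_pi_stdGaussian {H : Type*} [NormedAddCommGroup H] [InnerProductSpace ℝ H]
    [FiniteDimensional ℝ H] [MeasurableSpace H] [BorelSpace H] :
    (Measure.pi fun _ : ι => stdGaussian H).map (WithLp.toLp 2) =
      stdGaussian (PiLp 2 fun _ : ι => H) := by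
  refine Measure.ext_of_charFun (E := PiLp 2 fun _ : ι => H) ?_
  ext t
  rw [charFun_stdGaussian, charFun_pi]
  simp_rw [charFun_stdGaussian, ← Complex.exp_sum, ← Complex.ofReal_pow, PiLp.norm_sq_eq_of_L2]
  push_cast
  rw [← Finset.sum_div, ← Finset.sum_neg_distrib]

/-- The rows of a matrix given by its columnwise vectorization, as an isometry. -/
noncomputable def rowsIsometry (ι κ : Type*) [Fintype ι] [Fintype κ] :
    EuclideanSpace ℝ (κ × ι) ≃ₗᵢ[ℝ] PiLp 2 fun _ : ι => EuclideanSpace ℝ κ where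
  toFun v := WithLp.toLp 2 fun i => WithLp.toLp 2 fun j => v (j, i)
  invFun w := WithLp.toLp 2 fun a => w a.2 a.1
  map_add' _ _ := rfl
  map_smul' _ _ := rfl
  left_inv _ := rfl
  right_inv _ := rfl
  norm_map' v := by
    rw [← sq_eq_sq₀ (norm_nonneg _) (norm_nonneg _), PiLp.norm_sq_eq_of_L2,
      PiLp.norm_sq_eq_of_L2]
    simp only [PiLp.norm_sq_eq_of_L2, Fintype.sum_prod_type]
    exact Finset.sum_comm

theorem rowsIsometry_apply (v : EuclideanSpace ℝ (κ × ι)) (i : ι) (j : κ) :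
    rowsIsometry ι κ v i j = v (j, i) := rfl

theorem gram_rowsIsometry (v : EuclideanSpace ℝ (κ × ι)) :
    Matrix.gram ℝ (WithLp.ofLp (rowsIsometry ι κ v)) =
      unvec (WithLp.ofLp v) * (unvec (WithLp.ofLp v))ᵀ := by
  ext i j
  simp [Matrix.gram_apply, Matrix.mul_apply, rowsIsometry_apply, unvec, PiLp.inner_apply, mul_comm]

/-- Splitting a vectorized matrix into rows is an isometry, hence preserves the standard Gaussian
law, and turns `X Xᵀ` into a Gram matrix. -/
theorem lintegral_gram_stdGaussian [DecidableEq ι] {f : Matrix ι ι ℝ → ENNReal}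
    (hf : Measurable f) :
    ∫⁻ v, f (unvec (WithLp.ofLp v) * (unvec (WithLp.ofLp v))ᵀ)
        ∂stdGaussian (EuclideanSpace ℝ (κ × ι)) =
      ∫⁻ x, f (Matrix.gram ℝ x) ∂Measure.pi fun _ : ι => stdGaussian (EuclideanSpace ℝ κ) := by
  have hg : Measurable fun x : ι → EuclideanSpace ℝ κ => Matrix.gram ℝ x :=
    measurable_pi_lambda _ fun i => measurable_pi_lambda _ fun j => by
      simp only [Matrix.gram_apply]
      fun_prop
  have hm : Measurable fun w : PiLp 2 fun _ : ι => EuclideanSpace ℝ κ =>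
      f (Matrix.gram ℝ (WithLp.ofLp w)) := hf.comp (hg.comp (WithLp.measurable_ofLp 2 _))
  have h1 := lintegral_map (μ := Measure.pi fun _ : ι => stdGaussian (EuclideanSpace ℝ κ)) hm
    (WithLp.measurable_toLp 2 _)
  rw [map_toLp_pi_stdGaussian, ← stdGaussian_map (rowsIsometry ι κ),
    lintegral_map hm (rowsIsometry ι κ).continuous.measurable] at h1
  simpa only [gram_rowsIsometry] using h1

end GaussianMatrix

/-! ### Elliptical laws under linear maps -/

section EllipticalLaw

variable {ι : Type*} [Fintype ι] [DecidableEq ι]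

theorem measurable_density {h : ℝ → ℝ} (hh : Measurable fun t : Set.Ici (0 : ℝ) => h t)
    {M : Matrix ι ι ℝ} (hM : M.PosDef) : Measurable fun x : ι → ℝ =>
      ENNReal.ofReal (M.det ^ (-(1 / 2) : ℝ) * h (x ⬝ᵥ (M⁻¹ *ᵥ x))) := by
  refine (Measurable.const_mul ?_ _).ennreal_ofReal
  refine measurable_comp_of_nonneg hh ?_ fun x => by
    simpa using hM.inv.posSemidef.dotProduct_mulVec_nonneg x
  exact (Continuous.dotProduct continuous_id
    (Continuous.matrix_mulVec continuous_const continuous_id)).measurable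

theorem posDef_mul_mul_transpose {M L : Matrix ι ι ℝ} (hM : M.PosDef) (hL : L.det ≠ 0) :
    (L * M * Lᵀ).PosDef := by
  have := hM.mul_mul_conjTranspose_same (B := L)
    (Matrix.vecMul_injective_of_isUnit ((Matrix.isUnit_iff_isUnit_det L).2 hL.isUnit))
  simpa using this

/-- Linear change of variables: the quadratic form is preserved, and the Jacobian `|det L|` turns
one normalizing power of the determinant into the other. -/
theorem map_mulVec_ellipticalLaw {h : ℝ → ℝ} (hh : Measurable fun t : Set.Ici (0 : ℝ) => h t)
    {M L : Matrix ι ι ℝ} (hM : M.PosDef) (hL : L.det ≠ 0) :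
    (ellipticalLaw M h).map (L *ᵥ ·) = ellipticalLaw (L * M * Lᵀ) h := by
  have hLm : Measurable fun x : ι → ℝ => L *ᵥ x :=
    (Continuous.matrix_mulVec continuous_const continuous_id).measurable
  have hvol : (volume : Measure (ι → ℝ)) =
      ENNReal.ofReal |L.det| • Measure.map (L *ᵥ ·) volume := by
    have := Real.map_matrix_volume_pi_eq_smul_volume_pi hL
    rw [show (Matrix.toLin' L : (ι → ℝ) → ι → ℝ) = (L *ᵥ ·) from rfl] at this
    rw [this, smul_smul, ← ENNReal.ofReal_mul (abs_nonneg _), ← abs_mul, mul_inv_cancel₀ hL,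
      abs_one, ENNReal.ofReal_one, one_smul]
  have hden := measurable_density hh (posDef_mul_mul_transpose hM hL)
  have hdet : |L.det| * (L * M * Lᵀ).det ^ (-(1 / 2) : ℝ) = M.det ^ (-(1 / 2) : ℝ) := by
    have habs : 0 < |L.det| := abs_pos.2 hL
    rw [Matrix.det_mul, Matrix.det_mul, Matrix.det_transpose,
      show L.det * M.det * L.det = |L.det| ^ (2 : ℝ) * M.det by
        rw [Real.rpow_two, sq_abs]; ring,
      Real.mul_rpow (by positivity) hM.det_pos.le, ← Real.rpow_mul habs.le, ← mul_assoc]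
    norm_num
    rw [Real.rpow_neg_one, mul_inv_cancel₀ habs.ne', one_mul]
  have hquad : ∀ x : ι → ℝ, (L *ᵥ x) ⬝ᵥ ((L * M * Lᵀ)⁻¹ *ᵥ (L *ᵥ x)) = x ⬝ᵥ (M⁻¹ *ᵥ x) := by
    intro x
    have hu : IsUnit L.det := hL.isUnit
    rw [Matrix.mul_inv_rev, Matrix.mul_inv_rev, Matrix.mulVec_mulVec, Matrix.mul_assoc,
      Matrix.mul_assoc, Matrix.nonsing_inv_mul _ hu, Matrix.mul_one, ← Matrix.mulVec_mulVec,
      ← Matrix.transpose_nonsing_inv, Matrix.mulVec_transpose,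
      dotProduct_comm, ← Matrix.dotProduct_mulVec, Matrix.mulVec_mulVec,
      Matrix.nonsing_inv_mul _ hu, Matrix.one_mulVec, dotProduct_comm]
  ext s hs
  rw [Measure.map_apply hLm hs, ellipticalLaw, ellipticalLaw, withDensity_apply _ (hLm hs),
    withDensity_apply _ hs]
  conv_rhs => rw [hvol]
  rw [Measure.restrict_smul, lintegral_smul_measure,
    setLIntegral_map hs hden hLm, smul_eq_mul,
    ← lintegral_const_mul' _ _ ENNReal.ofReal_ne_top]
  refine lintegral_congr fun x => ?_
  rw [hquad, ← ENNReal.ofReal_mul (abs_nonneg _), ← mul_assoc, hdet]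

end EllipticalLaw

/-! ### Elliptical Wishart laws and reduction to the Gaussian case -/

section Wishart

variable {p n : ℕ}

theorem measurable_unvec {m n : Type*} : Measurable (unvec : (n × m → ℝ) → Matrix m n ℝ) :=
  measurable_pi_lambda _ fun i => measurable_pi_lambda _ fun j => measurable_pi_apply (j, i)

theorem measurable_mul_transpose_self {m n : Type*} [Fintype m] [Fintype n] :
    Measurable fun X : Matrix m n ℝ => X * Xᵀ :=
  (Continuous.matrix_mul continuous_id continuous_id.matrix_transpose).measurable

theorem measurable_mul_mul_transpose {m : Type*} [Fintype m] (B : Matrix m m ℝ) :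
    Measurable fun S : Matrix m m ℝ => B * S * Bᵀ :=
  (Continuous.matrix_mul (Continuous.matrix_mul continuous_const continuous_id)
    continuous_const).measurable

theorem ellipticalWishartLaw_eq_map (S : Matrix (Fin p) (Fin p) ℝ) (h : ℝ → ℝ) :
    ellipticalWishartLaw n S h =
      (ellipticalLaw ((1 : Matrix (Fin n) (Fin n) ℝ) ⊗ₖ S) h).map
        fun v => unvec v * (unvec v)ᵀ := by
  rw [ellipticalWishartLaw, matrixEllipticalLaw,
    Measure.map_map measurable_mul_transpose_self measurable_unvec]
  rfl

theorem measurable_unvec_mul_transpose :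
    Measurable fun v : Fin n × Fin p → ℝ => unvec v * (unvec v)ᵀ :=
  measurable_mul_transpose_self.comp measurable_unvec

/-- Since `vec (B X) = (I ⊗ B) vec X`, this is the linear equivariance of elliptical laws applied to
`I ⊗ B`. -/
theorem map_congr_ellipticalWishartLaw {h : ℝ → ℝ}
    (hh : Measurable fun t : Set.Ici (0 : ℝ) => h t) {M B : Matrix (Fin p) (Fin p) ℝ}
    (hM : M.PosDef) (hB : B.det ≠ 0) :
    (ellipticalWishartLaw n M h).map (fun S => B * S * Bᵀ) =
      ellipticalWishartLaw n (B * M * Bᵀ) h := by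
  have hL : ((1 : Matrix (Fin n) (Fin n) ℝ) ⊗ₖ B).det ≠ 0 := by
    rw [Matrix.det_kronecker]
    simpa using fun h => absurd h hB
  have e : (1 : Matrix (Fin n) (Fin n) ℝ) ⊗ₖ (B * M * Bᵀ) =
      (1 ⊗ₖ B) * (1 ⊗ₖ M) * ((1 : Matrix (Fin n) (Fin n) ℝ) ⊗ₖ B)ᵀ := by
    rw [← Matrix.kroneckerMap_transpose, ← Matrix.mul_kronecker_mul, ← Matrix.mul_kronecker_mul]
    simp
  have hLm : Measurable fun x : Fin n × Fin p → ℝ =>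
      ((1 : Matrix (Fin n) (Fin n) ℝ) ⊗ₖ B) *ᵥ x :=
    (Continuous.matrix_mulVec continuous_const continuous_id).measurable
  rw [ellipticalWishartLaw_eq_map, ellipticalWishartLaw_eq_map, e,
    ← map_mulVec_ellipticalLaw hh (Matrix.PosDef.one.kronecker hM) hL,
    Measure.map_map measurable_unvec_mul_transpose hLm,
    Measure.map_map (measurable_mul_mul_transpose B) measurable_unvec_mul_transpose]
  congr 1
  funext v
  simp only [Function.comp_apply]
  rw [← vec_unvec v, Matrix.kronecker_mulVec_vec, unvec_vec, unvec_vec]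
  simp [Matrix.mul_assoc]

theorem lintegral_ellipticalWishartLaw_one {h : ℝ → ℝ}
    (hh : Measurable fun t : Set.Ici (0 : ℝ) => h t) {f : Matrix (Fin p) (Fin p) ℝ → ENNReal}
    (hf : Measurable f) :
    ∫⁻ S, f S ∂ellipticalWishartLaw n 1 h =
      ∫⁻ v : EuclideanSpace ℝ (Fin n × Fin p),
        f (unvec (WithLp.ofLp v) * (unvec (WithLp.ofLp v))ᵀ) * ENNReal.ofReal (h (‖v‖ ^ 2)) := by
  have hfm : Measurable fun v : Fin n × Fin p → ℝ => f (unvec v * (unvec v)ᵀ) :=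
    hf.comp measurable_unvec_mul_transpose
  have hd := measurable_density (ι := Fin n × Fin p) hh Matrix.PosDef.one
  rw [ellipticalWishartLaw_eq_map, Matrix.one_kronecker_one, ellipticalLaw,
    lintegral_map hf measurable_unvec_mul_transpose,
    lintegral_withDensity_eq_lintegral_mul _ hd hfm,
    ← (PiLp.volume_preserving_ofLp (Fin n × Fin p)).lintegral_comp (hd.mul hfm)]
  refine lintegral_congr fun v => ?_
  have : WithLp.ofLp v ⬝ᵥ WithLp.ofLp v = ‖v‖ ^ 2 := by
    rw [EuclideanSpace.real_norm_sq_eq]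
    simp [dotProduct, sq]
  simp [this, mul_comm]

/-- Expectations of homogeneous functions of an elliptical Wishart matrix are those of the Gaussian
case, up to a ratio of modular moments. -/
theorem lintegral_ellipticalWishartLaw_homogeneous (hnp : 0 < n * p) {h : ℝ → ℝ}
    (hh : Measurable fun t : Set.Ici (0 : ℝ) => h t) (h0 : ∀ t, 0 ≤ t → 0 ≤ h t) {k : ℤ}
    (hk : FiniteModularMoment (n * p) h k) (hk' : 0 < ((n * p : ℕ) : ℝ) / 2 + k)
    {f : Matrix (Fin p) (Fin p) ℝ → ENNReal} (hf : Measurable f)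
    (hfk : ∀ r : ℝ, 0 < r → ∀ S, f (r ^ 2 • S) = ENNReal.ofReal (r ^ (2 * k)) * f S) :
    (∫⁻ S, f S ∂ellipticalWishartLaw n 1 h) *
        ENNReal.ofReal (modularMoment (n * p) (gaussianGenerator (n * p)) k) =
      (∫⁻ x, f (Matrix.gram ℝ x)
          ∂Measure.pi fun _ : Fin p => stdGaussian (EuclideanSpace ℝ (Fin n))) *
        ENNReal.ofReal (modularMoment (n * p) h k) := by
  have hfin : Module.finrank ℝ (EuclideanSpace ℝ (Fin n × Fin p)) = n * p := by simp
  have : Nontrivial (EuclideanSpace ℝ (Fin n × Fin p)) :=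
    Module.nontrivial_of_finrank_pos (R := ℝ) (by omega)
  have hfm : Measurable fun v : EuclideanSpace ℝ (Fin n × Fin p) =>
      f (unvec (WithLp.ofLp v) * (unvec (WithLp.ofLp v))ᵀ) :=
    hf.comp (measurable_unvec_mul_transpose.comp (WithLp.measurable_ofLp 2 _))
  have hhom : ∀ r : ℝ, 0 < r → ∀ v : EuclideanSpace ℝ (Fin n × Fin p),
      f (unvec (WithLp.ofLp (r • v)) * (unvec (WithLp.ofLp (r • v)))ᵀ) =
        ENNReal.ofReal (r ^ (2 * k)) * f (unvec (WithLp.ofLp v) * (unvec (WithLp.ofLp v))ᵀ) := by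
    intro r hr v
    rw [← hfk r hr, show unvec (WithLp.ofLp (r • v)) = r • unvec (WithLp.ofLp v) from rfl,
      Matrix.transpose_smul, Matrix.smul_mul, Matrix.mul_smul, smul_smul, sq]
  have hG := measurable_gaussianGenerator (n * p)
  -- The same spherical integral appears in `e1` and `e2`. Because the claim is cross-multiplied by
  -- the modular moments, that integral need be neither evaluated nor finite.
  have e1 := lintegral_homogeneous_mul_generator hfm k hhom hh h0 (hfin ▸ hk)
  have e2 := lintegral_homogeneous_mul_generator hfm k hhom (hG.comp measurable_subtype_coe)
    (fun t _ => gaussianGenerator_nonneg _ t)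
    (by rw [hfin]; exact finiteModularMoment_gaussianGenerator hk')
  have e3 := lintegral_gram_stdGaussian (κ := Fin n) hf
  have hGm : Measurable fun v : EuclideanSpace ℝ (Fin n × Fin p) =>
      ENNReal.ofReal (gaussianGenerator (n * p) (‖v‖ ^ 2)) :=
    (hG.comp (by fun_prop)).ennreal_ofReal
  rw [stdGaussian_eq_withDensity, hfin, lintegral_withDensity_eq_lintegral_mul _ hGm hfm] at e3
  simp only [Pi.mul_apply, mul_comm (ENNReal.ofReal (gaussianGenerator _ _))] at e3
  rw [hfin] at e1 e2
  have hc := radialConstant_pos hnp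
  rw [lintegral_ellipticalWishartLaw_one hh hf, ← e3, e1, e2, div_eq_mul_one_div,
    div_eq_mul_one_div (modularMoment _ (gaussianGenerator _) _),
    mul_comm (modularMoment _ _ _), mul_comm (modularMoment _ _ _),
    ENNReal.ofReal_mul (by positivity), ENNReal.ofReal_mul (by positivity)]
  ring

end Wishart

/-! ### Second moments of orthogonally invariant symmetric matrices -/

section Invariant

theorem sq_apply_le_of_posSemidef {ι : Type*} {W : Matrix ι ι ℝ} (hW : W.PosSemidef) (i j : ι) :
    W i j ^ 2 ≤ W i i * W j j := by
  have h := (hW.submatrix ![i, j]).det_nonneg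
  rw [Matrix.det_fin_two] at h
  have hs : W j i = W i j := by simpa using hW.isHermitian.apply i j
  simp [hs] at h
  nlinarith

theorem abs_apply_le_of_posSemidef {ι : Type*} {W : Matrix ι ι ℝ} (hW : W.PosSemidef) (i j : ι) :
    |W i j| ≤ W i i + W j j := by
  have h := sq_apply_le_of_posSemidef hW i j
  have hi : 0 ≤ W i i := hW.diag_nonneg
  have hj : 0 ≤ W j j := hW.diag_nonneg
  refine abs_le_of_sq_le_sq ?_ (by positivity)
  nlinarith

theorem integral_entry_mul_swap {ι : Type*} {κ : Measure (Matrix ι ι ℝ)}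
    (hsymm : ∀ᵐ W ∂κ, W.IsHermitian) (i j k l : ι) :
    ∫ W : Matrix ι ι ℝ, W i j * W k l ∂κ = ∫ W, W i j * W l k ∂κ := by
  refine integral_congr_ae ?_
  filter_upwards [hsymm] with W hW
  rw [show W k l = W l k by simpa using hW.apply l k]

theorem integral_entry_mul_comm {ι : Type*} {κ : Measure (Matrix ι ι ℝ)} (i j k l : ι) :
    ∫ W : Matrix ι ι ℝ, W i j * W k l ∂κ = ∫ W, W k l * W i j ∂κ :=
  integral_congr_ae (ae_of_all _ fun _ => mul_comm _ _)

/-- For a positive semidefinite matrix, each entry is dominated by the sum of the two corresponding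
diagonal entries. -/
theorem memLp_apply_of_diag {ι : Type*} [Countable ι] {κ : Measure (Matrix ι ι ℝ)} (hpos : ∀ᵐ W ∂κ, W.PosSemidef)
    (hfin : ∀ i, ∫⁻ W, ENNReal.ofReal (W i i ^ 2) ∂κ ≠ ⊤) (i j : ι) :
    MemLp (fun W : Matrix ι ι ℝ => W i j) 2 κ := by
  have hdiag : ∀ i, MemLp (fun W : Matrix ι ι ℝ => W i i) 2 κ := by
    intro i
    rw [memLp_two_iff_integrable_sq (measurable_matrix_entry i i).aestronglyMeasurable]
    refine ⟨((measurable_matrix_entry i i).pow_const 2).aestronglyMeasurable, ?_⟩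
    rw [hasFiniteIntegral_iff_ofReal (ae_of_all _ fun W => sq_nonneg _)]
    exact (hfin i).lt_top
  refine ((hdiag i).add (hdiag j)).mono (measurable_matrix_entry i j).aestronglyMeasurable ?_
  filter_upwards [hpos] with W hW
  exact (abs_apply_le_of_posSemidef hW i j).trans (le_abs_self _)

variable {ι : Type*} [Fintype ι]

theorem mul_mul_transpose_apply {m : Type*} (R : Matrix m ι ℝ) (W : Matrix ι ι ℝ) (i j : m) :
    (R * W * Rᵀ) i j = ∑ a, ∑ b, R i a * R j b * W a b := by
  simp only [Matrix.mul_apply, Matrix.transpose_apply, Finset.sum_mul]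
  rw [Finset.sum_comm]
  exact Finset.sum_congr rfl fun a _ => Finset.sum_congr rfl fun b _ => by ring

theorem integral_mul_mul_transpose {κ : Measure (Matrix ι ι ℝ)} [IsFiniteMeasure κ]
    (hL : ∀ i j, MemLp (fun W : Matrix ι ι ℝ => W i j) 2 κ) {m : Type*} (R : Matrix m ι ℝ)
    (i j : m) :
    ∫ W, (R * W * Rᵀ) i j ∂κ = ∑ a, ∑ b, R i a * R j b * ∫ W, W a b ∂κ := by
  have hI : ∀ a b, Integrable (fun W : Matrix ι ι ℝ => W a b) κ := fun a b =>
    (hL a b).integrable one_le_two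
  simp_rw [mul_mul_transpose_apply]
  rw [integral_finsetSum _ fun a _ => integrable_finsetSum _ fun b _ => (hI a b).const_mul _]
  refine Finset.sum_congr rfl fun a _ => ?_
  rw [integral_finsetSum _ fun b _ => (hI a b).const_mul _]
  exact Finset.sum_congr rfl fun b _ => integral_const_mul _ _

theorem integral_mul_mul_transpose_mul {κ : Measure (Matrix ι ι ℝ)}
    (hL : ∀ i j, MemLp (fun W : Matrix ι ι ℝ => W i j) 2 κ) {m : Type*} (R : Matrix m ι ℝ)
    (i j k l : m) :
    ∫ W, (R * W * Rᵀ) i j * (R * W * Rᵀ) k l ∂κ =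
      ∑ a, ∑ b, ∑ c, ∑ d, R i a * R j b * R k c * R l d * ∫ W, W a b * W c d ∂κ := by
  have hI : ∀ a b c d, Integrable (fun W : Matrix ι ι ℝ => W a b * W c d) κ := fun a b c d =>
    (hL a b).integrable_mul (hL c d)
  have e : ∀ W : Matrix ι ι ℝ, (R * W * Rᵀ) i j * (R * W * Rᵀ) k l =
      ∑ a, ∑ b, ∑ c, ∑ d, R i a * R j b * R k c * R l d * (W a b * W c d) := by
    intro W
    simp_rw [mul_mul_transpose_apply, Finset.sum_mul, Finset.mul_sum]
    refine Finset.sum_congr rfl fun a _ => Finset.sum_congr rfl fun b _ =>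
      Finset.sum_congr rfl fun c _ => Finset.sum_congr rfl fun d _ => by ring
  simp_rw [e]
  rw [integral_finsetSum _ fun a _ => integrable_finsetSum _ fun b _ =>
    integrable_finsetSum _ fun c _ => integrable_finsetSum _ fun d _ => (hI a b c d).const_mul _]
  refine Finset.sum_congr rfl fun a _ => ?_
  rw [integral_finsetSum _ fun b _ =>
    integrable_finsetSum _ fun c _ => integrable_finsetSum _ fun d _ => (hI a b c d).const_mul _]
  refine Finset.sum_congr rfl fun b _ => ?_
  rw [integral_finsetSum _ fun c _ => integrable_finsetSum _ fun d _ => (hI a b c d).const_mul _]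
  refine Finset.sum_congr rfl fun c _ => ?_
  rw [integral_finsetSum _ fun d _ => (hI a b c d).const_mul _]
  exact Finset.sum_congr rfl fun d _ => integral_const_mul _ _

variable [DecidableEq ι]

/-- The law of a random matrix is invariant under conjugation by orthogonal matrices. -/
def IsOrthogonallyInvariant (κ : Measure (Matrix ι ι ℝ)) : Prop :=
  ∀ Q : Matrix ι ι ℝ, Q * Qᵀ = 1 → κ.map (fun W => Q * W * Qᵀ) = κ

namespace IsOrthogonallyInvariant

variable {κ : Measure (Matrix ι ι ℝ)}

theorem integral_comp (hκ : IsOrthogonallyInvariant κ) {Q : Matrix ι ι ℝ} (hQ : Q * Qᵀ = 1)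
    {F : Matrix ι ι ℝ → ℝ} (hF : Measurable F) :
    ∫ W, F (Q * W * Qᵀ) ∂κ = ∫ W, F W ∂κ := by
  conv_rhs => rw [← hκ Q hQ]
  rw [integral_map (measurable_mul_mul_transpose Q).aemeasurable hF.aestronglyMeasurable]

theorem integral_sign (hκ : IsOrthogonallyInvariant κ) {s : ι → ℝ} (hs : ∀ i, s i * s i = 1)
    (i j : ι) : ∫ W : Matrix ι ι ℝ, s i * s j * W i j ∂κ = ∫ W, W i j ∂κ := by
  have hQ : Matrix.diagonal s * (Matrix.diagonal s)ᵀ = 1 := by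
    rw [Matrix.diagonal_transpose, Matrix.diagonal_mul_diagonal]
    simp [hs]
  rw [← hκ.integral_comp hQ (measurable_matrix_entry i j)]
  refine integral_congr_ae (ae_of_all _ fun W => ?_)
  simp only [Matrix.diagonal_transpose, Matrix.mul_diagonal, Matrix.diagonal_mul]
  ring

theorem integral_sign_mul (hκ : IsOrthogonallyInvariant κ) {s : ι → ℝ}
    (hs : ∀ i, s i * s i = 1) (i j k l : ι) :
    ∫ W : Matrix ι ι ℝ, s i * s j * s k * s l * (W i j * W k l) ∂κ =
      ∫ W, W i j * W k l ∂κ := by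
  have hQ : Matrix.diagonal s * (Matrix.diagonal s)ᵀ = 1 := by
    rw [Matrix.diagonal_transpose, Matrix.diagonal_mul_diagonal]
    simp [hs]
  rw [← hκ.integral_comp (F := fun W => W i j * W k l) hQ
    ((measurable_matrix_entry i j).mul (measurable_matrix_entry k l))]
  refine integral_congr_ae (ae_of_all _ fun W => ?_)
  simp only [Matrix.diagonal_transpose, Matrix.mul_diagonal, Matrix.diagonal_mul]
  ring

theorem integral_offDiag (hκ : IsOrthogonallyInvariant κ) {i j : ι} (hij : i ≠ j) :
    ∫ W : Matrix ι ι ℝ, W i j ∂κ = 0 := by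
  have h := hκ.integral_sign (s := fun k => if k = i then -1 else 1)
    (fun k => by split_ifs <;> norm_num) i j
  rw [integral_const_mul] at h
  simp only [if_true, if_neg hij.symm] at h
  linarith

/-- The hypothesis says that `a` occurs an odd number of times among the four indices; conjugating
by the sign change of coordinate `a` then negates the integral. -/
theorem integral_mul_eq_zero (hκ : IsOrthogonallyInvariant κ) {i j k l a : ι}
    (h : (if i = a then -1 else 1 : ℝ) * (if j = a then -1 else 1) * (if k = a then -1 else 1) *
      (if l = a then -1 else 1) = -1) :
    ∫ W : Matrix ι ι ℝ, W i j * W k l ∂κ = 0 := by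
  have h1 := hκ.integral_sign_mul (s := fun k => if k = a then -1 else 1)
    (fun k => by split_ifs <;> norm_num) i j k l
  rw [integral_const_mul] at h1
  simp only [h] at h1
  linarith

/-- Signs cannot relate the second moments of diagonal and off-diagonal entries; a transformation
mixing coordinates `i` and `j` does. Write `A` and `B` for the two integrals on the left. Expanding
the invariance of `E[W i i ^ 2]` and dropping the odd terms leaves `(81 + 256) α + 144 (2A + 4B) =
625 α`. -/
theorem integral_diag_mul_diag_add (hκ : IsOrthogonallyInvariant κ)
    (hL : ∀ i j, MemLp (fun W : Matrix ι ι ℝ => W i j) 2 κ) (hsymm : ∀ᵐ W ∂κ, W.IsHermitian)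
    {α : ℝ} (hα : ∀ i, ∫ W : Matrix ι ι ℝ, W i i ^ 2 ∂κ = α) {i j : ι} (hij : i ≠ j) :
    ∫ W : Matrix ι ι ℝ, W i i * W j j ∂κ + 2 * ∫ W : Matrix ι ι ℝ, W i j * W i j ∂κ = α := by
  -- The Householder reflection along `e_i - 2 e_j` has `i`-th row `(3/5, 4/5)` on the coordinates
  -- `i, j`: the 3-4-5 triangle keeps every coefficient rational.
  let w : ι → ℝ := Pi.single i 1 - (2 : ℝ) • Pi.single j 1
  let Q : Matrix ι ι ℝ := 1 - (2 / 5 : ℝ) • Matrix.vecMulVec w w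
  have hww : w ⬝ᵥ w = 5 := by
    simp [w, hij]
    norm_num
  have hQ : Q * Qᵀ = 1 := by
    have h1 : Qᵀ = Q := by simp [Q, Matrix.transpose_vecMulVec]
    rw [h1]
    simp only [Q, sub_mul, mul_sub, one_mul, mul_one, Matrix.smul_mul, Matrix.mul_smul,
      Matrix.vecMulVec_mul_vecMulVec, hww]
    ext a b
    simp [Matrix.vecMulVec_apply]
    ring
  have hrow : ∀ a, Q i a = 3 / 5 * (if a = i then 1 else 0) + 4 / 5 * (if a = j then 1 else 0) := by
    intro a
    simp only [Q, w, Matrix.sub_apply, Matrix.one_apply, Matrix.smul_apply,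
      Matrix.vecMulVec_apply, Pi.sub_apply, Pi.smul_apply, Pi.single_apply, smul_eq_mul, if_true,
      eq_comm (a := i)]
    by_cases h1 : a = i
    · subst h1
      simp [hij, hij.symm]
      norm_num
    · by_cases h2 : a = j
      · subst h2
        simp [h1]
        norm_num
      · simp [h1, h2]
  have hcomp := hκ.integral_comp (F := fun W => W i i * W i i) hQ
    ((measurable_matrix_entry i i).mul (measurable_matrix_entry i i))
  rw [integral_mul_mul_transpose_mul hL] at hcomp
  have hα' : ∀ i, ∫ W : Matrix ι ι ℝ, W i i * W i i ∂κ = α := fun i => by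
    simpa only [sq] using hα i
  have z : ∀ a b c d : ι, ((if a = i then -1 else 1 : ℝ) * (if b = i then -1 else 1) *
      (if c = i then -1 else 1) * (if d = i then -1 else 1) = -1) →
      ∫ W : Matrix ι ι ℝ, W a b * W c d ∂κ = 0 := fun a b c d h => hκ.integral_mul_eq_zero h
  simp only [hrow, add_mul, mul_add, Finset.sum_add_distrib, mul_ite, ite_mul, mul_one, mul_zero,
    zero_mul, Finset.sum_ite_eq', Finset.mem_univ, if_true, hα'] at hcomp
  have e1 := integral_entry_mul_swap hsymm i j j i
  have e2 := integral_entry_mul_comm (κ := κ) j i i j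
  have e3 := integral_entry_mul_swap hsymm j i j i
  have e4 := integral_entry_mul_comm (κ := κ) j j i i
  rw [z i i i j (by simp [hij.symm]), z i i j i (by simp [hij.symm]), z i j i i (by simp [hij.symm]),
    z j i i i (by simp [hij.symm]), z j j j i (by simp [hij.symm]), z j j i j (by simp [hij.symm]),
    z j i j j (by simp [hij.symm]), z i j j j (by simp [hij.symm]), e3, e2, e1, e4] at hcomp
  linarith

/-- For `i ≠ j`, put `A = E[W i i * W j j]` and `B = E[W i j ^ 2]`. Then `A + 2B = α` by the
reflection and `A - B = β` by definition, which fixes both. The other index patterns either reduce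
to these by symmetry or contain an index of odd multiplicity. -/
theorem integral_mul (hκ : IsOrthogonallyInvariant κ)
    (hL : ∀ i j, MemLp (fun W : Matrix ι ι ℝ => W i j) 2 κ) (hsymm : ∀ᵐ W ∂κ, W.IsHermitian)
    {α β : ℝ} (hα : ∀ i, ∫ W : Matrix ι ι ℝ, W i i ^ 2 ∂κ = α)
    (hβ : ∀ i j, i ≠ j → ∫ W : Matrix ι ι ℝ, (W i i * W j j - W i j ^ 2) ∂κ = β)
    (i j k l : ι) :
    ∫ W : Matrix ι ι ℝ, W i j * W k l ∂κ =
      (α + 2 * β) / 3 * ((1 : Matrix ι ι ℝ) i j * (1 : Matrix ι ι ℝ) k l) +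
        (α - β) / 3 * ((1 : Matrix ι ι ℝ) i k * (1 : Matrix ι ι ℝ) j l +
          (1 : Matrix ι ι ℝ) i l * (1 : Matrix ι ι ℝ) j k) := by
  have hα' : ∀ i, ∫ W : Matrix ι ι ℝ, W i i * W i i ∂κ = α := fun i => by
    simpa only [sq] using hα i
  have hI : ∀ a b c d, Integrable (fun W : Matrix ι ι ℝ => W a b * W c d) κ := fun a b c d =>
    (hL a b).integrable_mul (hL c d)
  have hAB : ∀ i j, i ≠ j → ∫ W : Matrix ι ι ℝ, W i i * W j j ∂κ = (α + 2 * β) / 3 ∧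
      ∫ W : Matrix ι ι ℝ, W i j * W i j ∂κ = (α - β) / 3 := by
    intro i j hij
    have h1 := hκ.integral_diag_mul_diag_add hL hsymm hα hij
    have h2 := hβ i j hij
    simp only [sq] at h2
    rw [integral_sub (hI i i j j) (hI i j i j)] at h2
    constructor <;> linarith
  simp only [Matrix.one_apply]
  by_cases hij : i = j
  · subst hij
    by_cases hkl : k = l
    · subst hkl
      by_cases hik : i = k
      · subst hik
        rw [hα']
        simp
        ring
      · rw [(hAB i k hik).1]
        simp [hik]
    · rw [hκ.integral_mul_eq_zero (a := k) (by by_cases h : i = k <;> simp [h, Ne.symm hkl])]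
      by_cases h : i = k
      · subst h; simp [hkl]
      · simp [hkl, h]
  · by_cases hkl : k = l
    · subst hkl
      rw [hκ.integral_mul_eq_zero (a := i) (by by_cases h : k = i <;> simp [h, Ne.symm hij])]
      by_cases h : i = k
      · subst h; simp [hij, Ne.symm hij]
      · simp [hij, h]
    · by_cases hik : i = k
      · subst hik
        by_cases hjl : j = l
        · subst hjl
          rw [(hAB i j hij).2]
          simp [hij]
        · rw [hκ.integral_mul_eq_zero (a := j) (by simp [hij, Ne.symm hjl])]
          simp [hij, hjl, hkl]
      · by_cases hil : i = l
        · subst hil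
          by_cases hjk : j = k
          · subst hjk
            rw [integral_entry_mul_swap hsymm, (hAB i j hij).2]
            simp [hij]
          · rw [hκ.integral_mul_eq_zero (a := j) (by simp [hij, Ne.symm hjk])]
            simp [hij, hik, hjk]
        · rw [hκ.integral_mul_eq_zero (a := i)
            (by simp [Ne.symm hij, Ne.symm hik, Ne.symm hil])]
          simp [hij, hik, hil]

end IsOrthogonallyInvariant

end Invariant

/-! ### Moments of the inverse for identity scatter -/

section StandardCase

variable {n p : ℕ} {h : ℝ → ℝ}

theorem inv_smul_apply {ι : Type*} [Fintype ι] [DecidableEq ι] {c : ℝ} (hc : c ≠ 0)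
    (S : Matrix ι ι ℝ) (i j : ι) : (c • S)⁻¹ i j = c⁻¹ * S⁻¹ i j := by
  have : (c • S)⁻¹ = c⁻¹ • S⁻¹ := by
    by_cases hS : IsUnit S.det
    · refine Matrix.inv_eq_left_inv ?_
      rw [Matrix.smul_mul, Matrix.mul_smul, Matrix.nonsing_inv_mul _ hS, smul_smul,
        inv_mul_cancel₀ hc, one_smul]
    · rw [Matrix.nonsing_inv_apply_not_isUnit _ hS, Matrix.nonsing_inv_apply_not_isUnit, smul_zero]
      rw [Matrix.det_smul]
      exact fun hu => hS (isUnit_of_mul_isUnit_right hu)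
  rw [this, Matrix.smul_apply, smul_eq_mul]

theorem inv_sq_smul_apply {ι : Type*} [Fintype ι] [DecidableEq ι] {r : ℝ} (hr : 0 < r)
    (S : Matrix ι ι ℝ) (i j : ι) : (r ^ 2 • S)⁻¹ i j = r ^ (2 * (-1 : ℤ)) * S⁻¹ i j := by
  rw [inv_smul_apply (by positivity), zpow_mul, zpow_neg_one]
  norm_cast

theorem modularMoment_nonneg (hnp : 0 < n) (h0 : ∀ t, 0 ≤ t → 0 ≤ h t) (k : ℤ) :
    0 ≤ modularMoment n h k := by
  refine mul_nonneg (radialConstant_pos hnp).le (setIntegral_nonneg measurableSet_Ioi fun t ht => ?_)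
  have ht : 0 < t := ht
  have := h0 t ht.le
  positivity

theorem eq_ofReal_of_mul_ofReal_eq {x : ENNReal} {a b : ℝ} (ha : 0 < a)
    (hx : x * ENNReal.ofReal a = ENNReal.ofReal b) : x = ENNReal.ofReal (b / a) := by
  rw [ENNReal.ofReal_div_of_pos ha, ← hx, ENNReal.mul_div_cancel_right]
  · simpa using ha
  · exact ENNReal.ofReal_ne_top

theorem finiteModularMoment_zero (hh : IsDensityGenerator n h) : FiniteModularMoment n h 0 := by
  by_contra hc
  have := hh.normalized
  rw [integral_undef, mul_zero] at this
  · exact zero_ne_one this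
  · simpa [FiniteModularMoment, IntegrableOn] using hc

theorem modularMoment_zero (hh : IsDensityGenerator n h) : modularMoment n h 0 = 1 := by
  rw [← hh.normalized]
  simp [modularMoment]

/-- This makes the Gaussian modular moment of order `-2` in dimension `np` converge. -/
theorem four_lt_mul (hp : 1 ≤ p) (hn : p + 3 < n) : 4 < n * p := by nlinarith

theorem isProbabilityMeasure_ellipticalWishartLaw_one (hp : 1 ≤ p) (hn : p + 3 < n)
    (hh : IsDensityGenerator (n * p) h) :
    IsProbabilityMeasure (ellipticalWishartLaw (p := p) n 1 h) := by
  have hd := four_lt_mul hp hn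
  have := lintegral_ellipticalWishartLaw_homogeneous (by omega) hh.measurable hh.nonneg
    (finiteModularMoment_zero hh)
    (by have : (0 : ℝ) < (n * p : ℕ) := by exact_mod_cast (by omega : 0 < n * p)
        push_cast at this ⊢; linarith)
    (f := fun _ => 1) measurable_const (by simp)
  rw [modularMoment_zero hh, modularMoment_gaussianGenerator_zero (by omega)] at this
  exact ⟨by simpa using this⟩

/-- The indicator of singular matrices is homogeneous of degree 0, so its integral transfers from
the Gaussian case, where the rows are almost surely independent. -/
theorem ae_det_ne_zero_ellipticalWishartLaw_one (hp : 1 ≤ p) (hn : p + 3 < n)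
    (hh : IsDensityGenerator (n * p) h) :
    ∀ᵐ S ∂ellipticalWishartLaw (p := p) n 1 h, S.det ≠ 0 := by
  have hd := four_lt_mul hp hn
  have hms : MeasurableSet {S : Matrix (Fin p) (Fin p) ℝ | S.det = 0} :=
    continuous_id.matrix_det.measurable (measurableSet_singleton 0)
  have := lintegral_ellipticalWishartLaw_homogeneous (by omega) hh.measurable hh.nonneg
    (finiteModularMoment_zero hh)
    (by have : (0 : ℝ) < (n * p : ℕ) := by exact_mod_cast (by omega : 0 < n * p)
        push_cast at this ⊢; linarith)
    (f := {S : Matrix (Fin p) (Fin p) ℝ | S.det = 0}.indicator 1) (measurable_one.indicator hms)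
    (fun r hr S => by
      by_cases hS : S.det = 0 <;> simp [hS, hr.ne'])
  rw [modularMoment_zero hh, modularMoment_gaussianGenerator_zero (by omega),
    lintegral_indicator_one hms, lintegral_eq_zero_of_ae_eq_zero] at this
  · rw [ae_iff]
    simpa using this
  · filter_upwards [ae_linearIndependent_pi_stdGaussian (ι := Fin p)
      (H := EuclideanSpace ℝ (Fin n)) (by simp; omega)] with x hx
    have := Matrix.det_gram_ne_zero_iff_linearIndependent.2 hx
    simp [this]

theorem lintegral_inv_diag (hp : 1 ≤ p) (hn : p + 3 < n) (hh : IsDensityGenerator (n * p) h)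
    (hm1 : FiniteModularMoment (n * p) h (-1)) (i : Fin p) :
    ∫⁻ S, ENNReal.ofReal (S⁻¹ i i) ∂ellipticalWishartLaw (p := p) n 1 h =
      ENNReal.ofReal (((n : ℝ) * p - 2) / ((n : ℝ) - p - 1) * modularMoment (n * p) h (-1)) := by
  have hd := four_lt_mul hp hn
  have hd' : (4 : ℝ) < n * p := by exact_mod_cast hd
  have hn' : (p : ℝ) + 3 < n := by exact_mod_cast hn
  have e := lintegral_ellipticalWishartLaw_homogeneous (by omega) hh.measurable hh.nonneg hm1
    (by push_cast; linarith) (f := fun S : Matrix (Fin p) (Fin p) ℝ => ENNReal.ofReal (S⁻¹ i i))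
    (measurable_matrix_inv_entry i i).ennreal_ofReal
    (fun r hr S => by rw [inv_sq_smul_apply hr, ENNReal.ofReal_mul (by positivity)])
  -- The other `p - 1` rows span a subspace of codimension `n - p + 1`.
  have eG := lintegral_inv_gram_diag (H := EuclideanSpace ℝ (Fin n)) i (m := 1) (D := n - p + 1)
    (by simp; omega) (by omega)
  simp only [pow_one, Nat.cast_one] at eG
  have hm0 := modularMoment_nonneg (n := n * p) (by omega) hh.nonneg (-1)
  have h1 : (0 : ℝ) < n - p - 1 := by linarith
  have h2 : (0 : ℝ) < n * p - 2 := by linarith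
  have hD : ((n - p + 1 : ℕ) : ℝ) - 2 = n - p - 1 := by
    push_cast [Nat.cast_sub (by omega : p ≤ n)]; ring
  rw [eG, modularMoment_gaussianGenerator_neg_one (by omega),
    modularMoment_gaussianGenerator_neg_one (by omega), hD,
    ← ENNReal.ofReal_mul (by positivity)] at e
  push_cast at e
  rw [eq_ofReal_of_mul_ofReal_eq (by positivity) e]
  congr 1
  field_simp

theorem lintegral_inv_diag_sq (hp : 1 ≤ p) (hn : p + 3 < n) (hh : IsDensityGenerator (n * p) h)
    (hm2 : FiniteModularMoment (n * p) h (-2)) (i : Fin p) :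
    ∫⁻ S, ENNReal.ofReal (S⁻¹ i i ^ 2) ∂ellipticalWishartLaw (p := p) n 1 h =
      ENNReal.ofReal (((n : ℝ) - p) * eCoeff n p h) := by
  have hd := four_lt_mul hp hn
  have hd' : (4 : ℝ) < n * p := by exact_mod_cast hd
  have hn' : (p : ℝ) + 3 < n := by exact_mod_cast hn
  have e := lintegral_ellipticalWishartLaw_homogeneous (by omega) hh.measurable hh.nonneg hm2
    (by push_cast; linarith)
    (f := fun S : Matrix (Fin p) (Fin p) ℝ => ENNReal.ofReal (S⁻¹ i i ^ 2))
    ((measurable_matrix_inv_entry i i).pow_const 2).ennreal_ofReal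
    (fun r hr S => by
      rw [inv_sq_smul_apply hr, ← ENNReal.ofReal_mul (by positivity), mul_pow, ← zpow_natCast,
        ← zpow_mul]
      norm_num)
  have eG := lintegral_inv_gram_diag (H := EuclideanSpace ℝ (Fin n)) i (m := 2) (D := n - p + 1)
    (by simp; omega) (by omega)
  simp only [Nat.cast_ofNat] at eG
  have hm0 := modularMoment_nonneg (n := n * p) (by omega) hh.nonneg (-2)
  have h1 : (0 : ℝ) < n - p - 1 := by linarith
  have h1' : (0 : ℝ) < n - p - 3 := by linarith
  have h1'' : (0 : ℝ) < n - p := by linarith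
  have h2 : (0 : ℝ) < n * p - 2 := by linarith
  have h3 : (0 : ℝ) < n * p - 4 := by linarith
  have hD : ((n - p + 1 : ℕ) : ℝ) - 2 = n - p - 1 := by
    push_cast [Nat.cast_sub (by omega : p ≤ n)]; ring
  have hD' : ((n - p + 1 : ℕ) : ℝ) - 4 = n - p - 3 := by
    push_cast [Nat.cast_sub (by omega : p ≤ n)]; ring
  rw [eG, modularMoment_gaussianGenerator_neg_two (by omega),
    modularMoment_gaussianGenerator_neg_two (by omega), hD, hD',
    ← ENNReal.ofReal_mul (by positivity)] at e
  push_cast at e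
  rw [eq_ofReal_of_mul_ofReal_eq (by positivity) e, eCoeff]
  congr 1
  field_simp

theorem lintegral_inv_minor (hp : 1 ≤ p) (hn : p + 3 < n) (hh : IsDensityGenerator (n * p) h)
    (hm2 : FiniteModularMoment (n * p) h (-2)) {i j : Fin p} (hij : i ≠ j) :
    ∫⁻ S, ENNReal.ofReal (S⁻¹ i i * S⁻¹ j j - S⁻¹ i j ^ 2)
        ∂ellipticalWishartLaw (p := p) n 1 h =
      ENNReal.ofReal (((n : ℝ) - p - 3) * eCoeff n p h) := by
  have hd := four_lt_mul hp hn
  have hd' : (4 : ℝ) < n * p := by exact_mod_cast hd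
  have hn' : (p : ℝ) + 3 < n := by exact_mod_cast hn
  have e := lintegral_ellipticalWishartLaw_homogeneous (by omega) hh.measurable hh.nonneg hm2
    (by push_cast; linarith)
    (f := fun S : Matrix (Fin p) (Fin p) ℝ =>
      ENNReal.ofReal (S⁻¹ i i * S⁻¹ j j - S⁻¹ i j ^ 2))
    (((measurable_matrix_inv_entry i i).mul (measurable_matrix_inv_entry j j)).sub
      ((measurable_matrix_inv_entry i j).pow_const 2)).ennreal_ofReal
    (fun r hr S => by
      rw [inv_sq_smul_apply hr, inv_sq_smul_apply hr, inv_sq_smul_apply hr,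
        ← ENNReal.ofReal_mul (by positivity)]
      congr 1
      have : r ^ (2 * (-2 : ℤ)) = r ^ (2 * (-1 : ℤ)) * r ^ (2 * (-1 : ℤ)) := by
        rw [← zpow_add₀ hr.ne']; norm_num
      rw [this]
      ring)
  have eG := lintegral_inv_gram_minor (H := EuclideanSpace ℝ (Fin n)) hij (D := n - p + 1)
    (by simp; omega) (by omega)
  have hm0 := modularMoment_nonneg (n := n * p) (by omega) hh.nonneg (-2)
  have h1 : (0 : ℝ) < n - p - 1 := by linarith
  have h1' : (0 : ℝ) < n - p - 3 := by linarith
  have h1'' : (0 : ℝ) < n - p := by linarith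
  have h2 : (0 : ℝ) < n * p - 2 := by linarith
  have h3 : (0 : ℝ) < n * p - 4 := by linarith
  have hD : ((n - p + 1 : ℕ) : ℝ) - 2 = n - p - 1 := by
    push_cast [Nat.cast_sub (by omega : p ≤ n)]; ring
  have hD' : ((n - p + 1 + 1 : ℕ) : ℝ) - 2 = n - p := by
    push_cast [Nat.cast_sub (by omega : p ≤ n)]; ring
  rw [eG, modularMoment_gaussianGenerator_neg_two (by omega),
    modularMoment_gaussianGenerator_neg_one (by omega),
    modularMoment_gaussianGenerator_neg_one (by omega), hD, hD',
    ← ENNReal.ofReal_mul (by positivity), ← ENNReal.ofReal_mul (by positivity)] at e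
  push_cast at e
  rw [eq_ofReal_of_mul_ofReal_eq (by positivity) e, eCoeff]
  congr 1
  field_simp

/-- The law of the inverse of a standard elliptical Wishart matrix. -/
noncomputable def inverseLaw (n p : ℕ) (h : ℝ → ℝ) : Measure (Matrix (Fin p) (Fin p) ℝ) :=
  (ellipticalWishartLaw n 1 h).map fun S => S⁻¹

theorem measurableSet_posSemidef {ι : Type*} [Fintype ι] :
    MeasurableSet {W : Matrix ι ι ℝ | W.PosSemidef} := by
  have e : {W : Matrix ι ι ℝ | W.PosSemidef} =
      {W | Wᵀ = W} ∩ ⋂ x : ι → ℝ, {W | 0 ≤ x ⬝ᵥ (W *ᵥ x)} := by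
    ext W
    simp [Matrix.posSemidef_iff_dotProduct_mulVec, Matrix.IsHermitian]
  rw [e]
  refine IsClosed.measurableSet (IsClosed.inter ?_ (isClosed_iInter fun x => ?_))
  · exact isClosed_eq continuous_id.matrix_transpose continuous_id
  · exact isClosed_le continuous_const
      (continuous_const.dotProduct (continuous_id.matrix_mulVec continuous_const))

theorem ae_posSemidef_inverseLaw : ∀ᵐ W ∂inverseLaw n p h, W.PosSemidef := by
  rw [inverseLaw, ellipticalWishartLaw_eq_map,
    Measure.map_map measurable_matrix_inv measurable_unvec_mul_transpose,
    ae_map_iff (measurable_matrix_inv.comp measurable_unvec_mul_transpose).aemeasurable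
      measurableSet_posSemidef]
  refine ae_of_all _ fun v => ?_
  have := (Matrix.posSemidef_self_mul_conjTranspose (unvec v)).inv
  simpa using this

/-- Conjugation by an orthogonal `Q` fixes the identity scatter and commutes with inversion, since
`Q⁻¹ = Qᵀ`. -/
theorem isOrthogonallyInvariant_inverseLaw (hh : IsDensityGenerator (n * p) h) :
    IsOrthogonallyInvariant (inverseLaw n p h) := by
  intro Q hQ
  have hdet : Q.det ≠ 0 := by
    intro h0
    have := congrArg Matrix.det hQ
    simp [h0] at this
  have hinv : Qᵀ = Q⁻¹ := (Matrix.inv_eq_right_inv hQ).symm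
  rw [inverseLaw, Measure.map_map (measurable_mul_mul_transpose Q) measurable_matrix_inv]
  have e := map_congr_ellipticalWishartLaw (n := n) hh.measurable Matrix.PosDef.one hdet
  rw [Matrix.mul_one, hQ] at e
  conv_rhs => rw [← e, Measure.map_map measurable_matrix_inv (measurable_mul_mul_transpose Q)]
  congr 1
  funext S
  simp only [Function.comp_apply, hinv, Matrix.mul_inv_rev, Matrix.mul_assoc]
  rw [Matrix.nonsing_inv_nonsing_inv _ hdet.isUnit]

theorem memLp_inverseLaw (hp : 1 ≤ p) (hn : p + 3 < n) (hh : IsDensityGenerator (n * p) h)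
    (hm2 : FiniteModularMoment (n * p) h (-2)) (i j : Fin p) :
    MemLp (fun W : Matrix (Fin p) (Fin p) ℝ => W i j) 2 (inverseLaw n p h) := by
  refine memLp_apply_of_diag ae_posSemidef_inverseLaw (fun i => ?_) i j
  rw [inverseLaw, lintegral_map ((measurable_matrix_entry i i).pow_const 2).ennreal_ofReal
    measurable_matrix_inv, lintegral_inv_diag_sq hp hn hh hm2]
  exact ENNReal.ofReal_ne_top

theorem eCoeff_nonneg (hp : 1 ≤ p) (hn : p + 3 < n) (hh : IsDensityGenerator (n * p) h) :
    0 ≤ eCoeff n p h := by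
  have hd := four_lt_mul hp hn
  have hd' : (4 : ℝ) < n * p := by exact_mod_cast hd
  have hn' : (p : ℝ) + 3 < n := by exact_mod_cast hn
  have hm0 := modularMoment_nonneg (n := n * p) (by omega) hh.nonneg (-2)
  have h1 : (0 : ℝ) < n - p - 1 := by linarith
  have h1' : (0 : ℝ) < n - p - 3 := by linarith
  have h1'' : (0 : ℝ) < n - p := by linarith
  have h2 : (0 : ℝ) < n * p - 2 := by linarith
  have h3 : (0 : ℝ) < n * p - 4 := by linarith
  unfold eCoeff
  positivity

theorem isProbabilityMeasure_inverseLaw (hp : 1 ≤ p) (hn : p + 3 < n)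
    (hh : IsDensityGenerator (n * p) h) : IsProbabilityMeasure (inverseLaw n p h) :=
  have := isProbabilityMeasure_ellipticalWishartLaw_one hp hn hh
  Measure.isProbabilityMeasure_map measurable_matrix_inv.aemeasurable

theorem integral_inverseLaw (hp : 1 ≤ p) (hn : p + 3 < n) (hh : IsDensityGenerator (n * p) h)
    (hm1 : FiniteModularMoment (n * p) h (-1)) (i j : Fin p) :
    ∫ W : Matrix (Fin p) (Fin p) ℝ, W i j ∂inverseLaw n p h =
      ((n : ℝ) * p - 2) / ((n : ℝ) - p - 1) * modularMoment (n * p) h (-1) *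
        (1 : Matrix (Fin p) (Fin p) ℝ) i j := by
  have hd := four_lt_mul hp hn
  have hd' : (4 : ℝ) < n * p := by exact_mod_cast hd
  have hn' : (p : ℝ) + 3 < n := by exact_mod_cast hn
  have hm0 := modularMoment_nonneg (n := n * p) (by omega) hh.nonneg (-1)
  have h1 : (0 : ℝ) < n - p - 1 := by linarith
  have h2 : (0 : ℝ) < n * p - 2 := by linarith
  by_cases hij : i = j
  · subst hij
    rw [integral_eq_lintegral_of_nonneg_ae
      (by filter_upwards [ae_posSemidef_inverseLaw] with W hW using hW.diag_nonneg)
      (measurable_matrix_entry i i).aestronglyMeasurable, inverseLaw,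
      lintegral_map (measurable_matrix_entry i i).ennreal_ofReal measurable_matrix_inv,
      lintegral_inv_diag hp hn hh hm1, ENNReal.toReal_ofReal (by positivity)]
    simp
  · rw [(isOrthogonallyInvariant_inverseLaw hh).integral_offDiag hij]
    simp [hij]

theorem integral_mul_inverseLaw (hp : 1 ≤ p) (hn : p + 3 < n) (hh : IsDensityGenerator (n * p) h)
    (hm2 : FiniteModularMoment (n * p) h (-2)) (i j k l : Fin p) :
    ∫ W : Matrix (Fin p) (Fin p) ℝ, W i j * W k l ∂inverseLaw n p h =
      ((n : ℝ) - p - 2) * eCoeff n p h *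
          ((1 : Matrix (Fin p) (Fin p) ℝ) i j * (1 : Matrix (Fin p) (Fin p) ℝ) k l) +
        eCoeff n p h * ((1 : Matrix (Fin p) (Fin p) ℝ) i k * (1 : Matrix (Fin p) (Fin p) ℝ) j l +
          (1 : Matrix (Fin p) (Fin p) ℝ) i l * (1 : Matrix (Fin p) (Fin p) ℝ) j k) := by
  have he := eCoeff_nonneg hp hn hh
  have hn' : (p : ℝ) + 3 < n := by exact_mod_cast hn
  have h1' : (0 : ℝ) < n - p - 3 := by linarith
  have h1'' : (0 : ℝ) < n - p := by linarith
  rw [(isOrthogonallyInvariant_inverseLaw hh).integral_mul (memLp_inverseLaw hp hn hh hm2)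
    (ae_posSemidef_inverseLaw.mono fun W hW => hW.isHermitian)
    -- With these values `(α + 2β)/3 = (n - p - 2) e` and `(α - β)/3 = e`.
    (α := ((n : ℝ) - p) * eCoeff n p h) (β := ((n : ℝ) - p - 3) * eCoeff n p h)
    (fun i => ?_) (fun i j hij => ?_)]
  · ring
  · rw [integral_eq_lintegral_of_nonneg_ae (ae_of_all _ fun W => sq_nonneg _)
      ((measurable_matrix_entry i i).pow_const 2).aestronglyMeasurable, inverseLaw,
      lintegral_map ((measurable_matrix_entry i i).pow_const 2).ennreal_ofReal
        measurable_matrix_inv,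
      lintegral_inv_diag_sq hp hn hh hm2, ENNReal.toReal_ofReal (by positivity)]
  · have hm : Measurable fun W : Matrix (Fin p) (Fin p) ℝ => W i i * W j j - W i j ^ 2 :=
      ((measurable_matrix_entry i i).mul (measurable_matrix_entry j j)).sub
        ((measurable_matrix_entry i j).pow_const 2)
    rw [integral_eq_lintegral_of_nonneg_ae
      (by filter_upwards [ae_posSemidef_inverseLaw] with W hW using
            sub_nonneg.2 (sq_apply_le_of_posSemidef hW i j))
      hm.aestronglyMeasurable, inverseLaw,
      lintegral_map hm.ennreal_ofReal measurable_matrix_inv,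
      lintegral_inv_minor hp hn hh hm2 hij, ENNReal.toReal_ofReal (by positivity)]

end StandardCase

/-! ### Transport to a general scatter matrix -/

section GeneralCase

open scoped MatrixOrder in
theorem exists_transpose_mul_self_eq {p : ℕ} {C : Matrix (Fin p) (Fin p) ℝ} (hC : C.PosDef) :
    ∃ B : Matrix (Fin p) (Fin p) ℝ, B.det ≠ 0 ∧ Bᵀ * B = C := by
  obtain ⟨B, hB⟩ := CStarAlgebra.nonneg_iff_eq_star_mul_self.mp hC.posSemidef.nonneg
  rw [Matrix.star_eq_conjTranspose, Matrix.conjTranspose_eq_transpose_of_trivial] at hB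
  refine ⟨B, fun h0 => hC.det_pos.ne' ?_, hB.symm⟩
  rw [hB, Matrix.det_mul, h0, mul_zero]

theorem hasLaw_of_isInverseEllipticalWishart {Ω : Type*} [MeasurableSpace Ω] {P : Measure Ω}
    {n p : ℕ} (hp : 1 ≤ p) (hn : p + 3 < n) {B : Matrix (Fin p) (Fin p) ℝ} (hB : B.det ≠ 0)
    {h : ℝ → ℝ} (hh : IsDensityGenerator (n * p) h) {S : Ω → Matrix (Fin p) (Fin p) ℝ}
    (hS : IsInverseEllipticalWishart P S n (Bᵀ * B) h) :
    HasLaw S ((inverseLaw n p h).map fun W => Bᵀ * W * Bᵀᵀ) P := by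
  have hBu : IsUnit B.det := hB.isUnit
  have hBi : B⁻¹.det ≠ 0 := by
    rw [Matrix.det_nonsing_inv, Ring.inverse_eq_inv']
    exact inv_ne_zero hB
  have e := map_congr_ellipticalWishartLaw (n := n) hh.measurable Matrix.PosDef.one hBi
  rw [Matrix.mul_one, Matrix.transpose_nonsing_inv, ← Matrix.mul_inv_rev] at e
  have hm := measurable_mul_mul_transpose B⁻¹
  rw [Matrix.transpose_nonsing_inv] at hm
  have hlaw : HasLaw (fun ω => (S ω)⁻¹) (ellipticalWishartLaw n (Bᵀ * B)⁻¹ h) P := hS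
  have hdet : ∀ᵐ T ∂ellipticalWishartLaw n (Bᵀ * B)⁻¹ h, T.det ≠ 0 := by
    have hms : MeasurableSet {T : Matrix (Fin p) (Fin p) ℝ | T.det ≠ 0} :=
      (continuous_id.matrix_det.measurable (measurableSet_singleton 0)).compl
    rw [← e, ae_map_iff hm.aemeasurable hms]
    filter_upwards [ae_det_ne_zero_ellipticalWishartLaw_one hp hn hh] with T hT
    have h1 : Bᵀ⁻¹.det ≠ 0 := by
      rw [← Matrix.transpose_nonsing_inv, Matrix.det_transpose]
      exact hBi
    rw [Matrix.det_mul, Matrix.det_mul]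
    exact mul_ne_zero (mul_ne_zero hBi hT) h1
  -- The hypothesis only controls `S⁻¹`, and a singular `S` has inverse 0 by convention. As `p ≥ 1`,
  -- that value has determinant 0, which the law of `S⁻¹` almost surely excludes.
  have hae : ∀ᵐ ω ∂P, S ω = (S ω)⁻¹⁻¹ := by
    rw [← hlaw.map_eq] at hdet
    filter_upwards [ae_of_ae_map hlaw.aemeasurable hdet] with ω hω
    have : Nonempty (Fin p) := ⟨⟨0, hp⟩⟩
    rw [Matrix.nonsing_inv_nonsing_inv]
    by_contra hu
    rw [Matrix.nonsing_inv_apply_not_isUnit _ hu, Matrix.det_zero] at hω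
    exact hω rfl
  refine HasLaw.congr (X := fun ω => (S ω)⁻¹⁻¹)
    ⟨measurable_matrix_inv.comp_aemeasurable hlaw.aemeasurable, ?_⟩ hae
  have e2 : P.map (fun ω => (S ω)⁻¹⁻¹) = (P.map fun ω => (S ω)⁻¹).map fun T => T⁻¹ :=
    (AEMeasurable.map_map_of_aemeasurable measurable_matrix_inv.aemeasurable
      hlaw.aemeasurable).symm
  rw [e2, hlaw.map_eq, ← e, inverseLaw, Measure.map_map measurable_matrix_inv hm,
    Measure.map_map (measurable_mul_mul_transpose Bᵀ) measurable_matrix_inv]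
  congr 1
  funext T
  have hBt : IsUnit Bᵀ.det := by rwa [Matrix.det_transpose]
  simp only [Function.comp_apply, Matrix.mul_inv_rev, Matrix.mul_assoc, Matrix.transpose_transpose]
  rw [Matrix.nonsing_inv_nonsing_inv _ hBu, Matrix.nonsing_inv_nonsing_inv _ hBt]

theorem sum_mul_one {ι m : Type*} [Fintype ι] [DecidableEq ι] (R : Matrix m ι ℝ) (c : ℝ)
    (i j : m) : ∑ a, ∑ b, R i a * R j b * (c * (1 : Matrix ι ι ℝ) a b) = c * (R * Rᵀ) i j := by
  simp only [Matrix.one_apply, mul_ite, mul_one, mul_zero, Finset.sum_ite_eq, Finset.mem_univ,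
    if_true, Matrix.mul_apply, Matrix.transpose_apply, Finset.mul_sum]
  exact Finset.sum_congr rfl fun a _ => mul_comm _ _

/-- Contracting an isotropic fourth-order tensor with four copies of `R` replaces each Kronecker
delta by `R Rᵀ`. -/
theorem sum_mul_isotropic {ι m : Type*} [Fintype ι] [DecidableEq ι] (R : Matrix m ι ℝ)
    (A B : ℝ) (i j k l : m) :
    ∑ a, ∑ b, ∑ c, ∑ d, R i a * R j b * R k c * R l d *
        (A * ((1 : Matrix ι ι ℝ) a b * (1 : Matrix ι ι ℝ) c d) +
          B * ((1 : Matrix ι ι ℝ) a c * (1 : Matrix ι ι ℝ) b d +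
            (1 : Matrix ι ι ℝ) a d * (1 : Matrix ι ι ℝ) b c)) =
      A * ((R * Rᵀ) i j * (R * Rᵀ) k l) +
        B * ((R * Rᵀ) i k * (R * Rᵀ) j l + (R * Rᵀ) i l * (R * Rᵀ) j k) := by
  have h1 : ∑ a, ∑ b, ∑ c, ∑ d, R i a * R j b * R k c * R l d *
      (A * ((1 : Matrix ι ι ℝ) a b * (1 : Matrix ι ι ℝ) c d)) =
      A * ((R * Rᵀ) i j * (R * Rᵀ) k l) := by
    simp only [Matrix.one_apply, mul_ite, mul_one, mul_zero,
      Finset.sum_ite_eq, Finset.mem_univ, if_true, Matrix.mul_apply, Matrix.transpose_apply,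
      Finset.sum_ite_irrel, Finset.sum_const_zero]
    rw [Finset.sum_mul_sum, Finset.mul_sum]
    refine Finset.sum_congr rfl fun a _ => ?_
    rw [Finset.mul_sum]
    exact Finset.sum_congr rfl fun b _ => by ring
  have h2 : ∑ a, ∑ b, ∑ c, ∑ d, R i a * R j b * R k c * R l d *
      (B * ((1 : Matrix ι ι ℝ) a c * (1 : Matrix ι ι ℝ) b d)) =
      B * ((R * Rᵀ) i k * (R * Rᵀ) j l) := by
    simp only [Matrix.one_apply, mul_ite, mul_one, mul_zero,
      Finset.sum_ite_eq, Finset.mem_univ, if_true, Matrix.mul_apply, Matrix.transpose_apply]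
    rw [Finset.sum_mul_sum, Finset.mul_sum]
    refine Finset.sum_congr rfl fun a _ => ?_
    rw [Finset.mul_sum]
    exact Finset.sum_congr rfl fun b _ => by ring
  have h3 : ∑ a, ∑ b, ∑ c, ∑ d, R i a * R j b * R k c * R l d *
      (B * ((1 : Matrix ι ι ℝ) a d * (1 : Matrix ι ι ℝ) b c)) =
      B * ((R * Rᵀ) i l * (R * Rᵀ) j k) := by
    simp only [Matrix.one_apply, mul_ite, mul_one, mul_zero,
      Finset.sum_ite_eq, Finset.mem_univ, if_true, Matrix.mul_apply, Matrix.transpose_apply,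
      Finset.sum_ite_irrel, Finset.sum_const_zero]
    rw [Finset.sum_mul_sum, Finset.mul_sum]
    refine Finset.sum_congr rfl fun a _ => ?_
    rw [Finset.mul_sum]
    exact Finset.sum_congr rfl fun b _ => by ring
  simp only [mul_add, Finset.sum_add_distrib, h1, h2, h3]

end GeneralCase

end EllipticalWishart

/-! ### The variance formula -/

open EllipticalWishart in
theorem mainTheorem8 {Ω : Type*} [MeasurableSpace Ω] (P : Measure Ω) [IsProbabilityMeasure P]
    (n p : ℕ) (hp : 1 ≤ p) (hn : p + 3 < n)
    (C : Matrix (Fin p) (Fin p) ℝ) (hC : C.PosDef)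
    (h : ℝ → ℝ) (hh : EllipticalWishart.IsDensityGenerator (n * p) h)
    (hm1 : EllipticalWishart.FiniteModularMoment (n * p) h (-1))
    (hm2 : EllipticalWishart.FiniteModularMoment (n * p) h (-2))
    (S : Ω → Matrix (Fin p) (Fin p) ℝ)
    (hS : EllipticalWishart.IsInverseEllipticalWishart P S n C h) :
    (∀ i j, MemLp (fun ω => S ω i j) 2 P) ∧
      EllipticalWishart.matrixVariance P S =
        EllipticalWishart.eCoeff n p h •
            ((1 + EllipticalWishart.commutationMatrix p p) * (C ⊗ₖ C)) +
          (((n : ℝ) - p - 2) * EllipticalWishart.fCoeff n p h) •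
            Matrix.vecMulVec C.vec C.vec := by
  obtain ⟨B, hB, rfl⟩ := exists_transpose_mul_self_eq hC
  have hlaw := hasLaw_of_isInverseEllipticalWishart hp hn hB hh hS
  have hL := memLp_inverseLaw hp hn hh hm2
  have hprob := isProbabilityMeasure_inverseLaw hp hn hh
  have hg := measurable_mul_mul_transpose Bᵀ
  have hint : ∀ F : Matrix (Fin p) (Fin p) ℝ → ℝ, Measurable F →
      ∫ ω, F (S ω) ∂P = ∫ W, F (Bᵀ * W * Bᵀᵀ) ∂inverseLaw n p h := by
    intro F hF
    rw [← integral_map hlaw.aemeasurable hF.aestronglyMeasurable, hlaw.map_eq,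
      integral_map hg.aemeasurable hF.aestronglyMeasurable]
  have hn' : (p : ℝ) + 3 < n := by exact_mod_cast hn
  have h2 : (n : ℝ) - p - 2 ≠ 0 := by linarith
  have h1 : (n : ℝ) - p - 1 ≠ 0 := by linarith
  constructor
  · intro i j
    have hm := (measurable_matrix_entry (m := Fin p) (n := Fin p) i j)
    have h3 : MemLp (fun W : Matrix (Fin p) (Fin p) ℝ => (Bᵀ * W * Bᵀᵀ) i j) 2
        (inverseLaw n p h) := by
      simp_rw [mul_mul_transpose_apply]
      exact memLp_finsetSum _ fun a _ => memLp_finsetSum _ fun b _ => (hL a b).const_mul _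
    have h4 := (memLp_map_measure_iff hm.aestronglyMeasurable hg.aemeasurable).2 h3
    rw [← hlaw.map_eq] at h4
    exact (memLp_map_measure_iff hm.aestronglyMeasurable hlaw.aemeasurable).1 h4
  · have hE : ∀ i j, ∫ ω, S ω i j ∂P = ((n : ℝ) * p - 2) / ((n : ℝ) - p - 1) *
        modularMoment (n * p) h (-1) * (Bᵀ * B) i j := by
      intro i j
      rw [hint _ (measurable_matrix_entry i j), integral_mul_mul_transpose hL]
      simp only [integral_inverseLaw hp hn hh hm1]
      rw [sum_mul_one, Matrix.transpose_transpose]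
    have hE2 : ∀ i j k l, ∫ ω, S ω i j * S ω k l ∂P =
        ((n : ℝ) - p - 2) * eCoeff n p h * ((Bᵀ * B) i j * (Bᵀ * B) k l) +
          eCoeff n p h * ((Bᵀ * B) i k * (Bᵀ * B) j l + (Bᵀ * B) i l * (Bᵀ * B) j k) := by
      intro i j k l
      rw [hint (fun W => W i j * W k l)
        ((measurable_matrix_entry i j).mul (measurable_matrix_entry k l)),
        integral_mul_mul_transpose_mul hL]
      simp only [integral_mul_inverseLaw hp hn hh hm2]
      rw [sum_mul_isotropic, Matrix.transpose_transpose]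
    -- Column-wise vectorization puts the column index first: position `(j, i)` of `vec S` holds `S
    -- i j`.
    ext ⟨j, i⟩ ⟨l, k⟩
    have hK : (commutationMatrix p p * ((Bᵀ * B) ⊗ₖ (Bᵀ * B))) (j, i) (l, k) =
        (Bᵀ * B) i l * (Bᵀ * B) j k := by
      -- Left multiplication by the commutation matrix only permutes rows, swapping the two
      -- components of the row index.
      have hcol : commutationMatrix p p * ((Bᵀ * B) ⊗ₖ (Bᵀ * B)) =
          ((Bᵀ * B) ⊗ₖ (Bᵀ * B)).submatrix Prod.swap id := by
        ext ⟨a, b⟩ c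
        have key : ∀ d : Fin p × Fin p, ((a, b) = d.swap) ↔ (d = (b, a)) := by
          rintro ⟨x, y⟩
          simp only [Prod.swap_prod_mk, Prod.mk.injEq]
          constructor <;> rintro ⟨h1, h2⟩ <;> exact ⟨h2.symm, h1.symm⟩
        rw [Matrix.mul_apply]
        simp only [commutationMatrix, Matrix.of_apply, key, ite_mul, one_mul, zero_mul,
          Finset.sum_ite_eq', Finset.mem_univ, if_true]
        rfl
      rw [hcol]
      rfl
    have hV : matrixVariance P S (j, i) (l, k) =
        (∫ ω, S ω i j * S ω k l ∂P) - (∫ ω, S ω i j ∂P) * ∫ ω, S ω k l ∂P := rfl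
    have hR : (eCoeff n p h • ((1 + commutationMatrix p p) * ((Bᵀ * B) ⊗ₖ (Bᵀ * B))) +
        (((n : ℝ) - p - 2) * fCoeff n p h) •
          Matrix.vecMulVec (Bᵀ * B).vec (Bᵀ * B).vec) (j, i) (l, k) =
        eCoeff n p h * ((Bᵀ * B) j l * (Bᵀ * B) i k +
          (commutationMatrix p p * ((Bᵀ * B) ⊗ₖ (Bᵀ * B))) (j, i) (l, k)) +
        (((n : ℝ) - p - 2) * fCoeff n p h) * ((Bᵀ * B) i j * (Bᵀ * B) k l) := by
      rw [add_mul, one_mul]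
      rfl
    -- The coefficients of `vec C vec Cᵀ` match because `(n - p - 2) f` is `(n - p - 2) e` minus the
    -- square of the scalar in the mean; the two sides also differ by the symmetry of `Bᵀ B` only as
    -- far as the index order already agrees.
    rw [hV, hR, hK, hE2, hE, hE, fCoeff]
    field_simp
    ring
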